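/- Let $p$ be a prime. If $p$ is odd, let $v\in\mathbb Q_p$ be any non-square with $|v|_p=1$ and put $(a,b)=(v,-p)$; if $p=2$, put $(a,b)=(-1,-1)$. Let $\mathbb H_p$ be the quaternion algebra over $\mathbb Q_p$ with basis $1,\mathbf i,\mathbf j,\mathbf k=\mathbf i\mathbf j=-\mathbf j\mathbf i$, $\mathbf i^2=a$, $\mathbf j^2=b$, with the topology of $\mathbb Q_p^4$, and let $\mathrm{nrd}(\xi)=Q_{(4)}(q)=q_0^2-aq_1^2-bq_2^2+abq_3^2$ be the reduced norm of $\xi=q_0+\mathbf i q_1+\mathbf j q_2+\mathbf k q_3$. Let $Q_+(x)=x_0^2-ax_1^2-bx_2^2$, with matrix $A=\mathrm{diag}(1,-a,-b)$, and $$\mathrm{SO}(3,\mathbb Q_p)=\{L\in \mathsf M_3(\mathbb Q_p) : A=L^\top A L,\ \det L=1\}.$$ Let $e$ be any linear isomorphism from $\mathbb Q_p^3$ onto the space $\mathbb H_p^0$ of pure imaginary quaternions such that $\mathrm{nrd}(e(x))=c_0\,Q_+(x)$ for all $x$, with a constant $c_0\neq0$ (such $e$ exist), and let $q\colon\mathbb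 H_p^\times\to\mathrm{SO}(3,\mathbb Q_p)$ be the homomorphism sending $\xi$ to the matrix of $x\mapsto e^{-1}(\xi\,e(x)\,\xi^{-1})$. Let $\mu_3$, $\mu_{\mathbb H_p^\times}$ and $\mu_{\mathbb Q_p^\times}$ be Haar measures on the groups $\mathrm{SO}(3,\mathbb Q_p)$, $\mathbb H_p^\times$ and $\mathbb Q_p^\times$ (the last one multiplicative), and let $\lambda$ be the Haar measure on $\mathbb Q_p^4$ with $\lambda(\mathbb Z_p^4)=1$. Let $\Psi$ be the set of all continuous compactly supported $\psi\colon\mathbb H_p^\times\to[0,\infty)$, $\psi\not\equiv0$, with $$\int_{\mathbb Q_p^\times}\psi(\xi z)\,d\mu_{\mathbb Q_p^\times}(z)=1\qquad\text{for all }\xi\in\mathbb H_p^\times .$$ For $\psi\in\Psi$ and $\phi\in \mathrm L^1(\mathrm{SO}(3,\mathbb Q_p),\mu_3)$ (complex-valued) define the extended Weil–Mackey–Bruhat lift $\widehat{\mathscr L}_\psi\phi:=\psi\cdot(\phi\circ q)$ on $\mathbb H_p^\times$. Then: 1. The measure $\mathcal E\mapsto\int_{\varphi(\mathcal E)}|Q_{(4)}(x)|_p^{-2}\,d\lambda(x)$,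 where $\varphi(\xi)=(q_0,q_1,q_2,q_3)$, is a Haar measure on $\mathbb H_p^\times$. 2. $\Psi$ is non-empty. 3. There is a normalization constant $c>0$, independent of $\phi$ and of $\psi$, such that for all $\psi\in\Psi$ and all $\phi\in \mathrm L^1(\mathrm{SO}(3,\mathbb Q_p),\mu_3)$ one has $\widehat{\mathscr L}_\psi\phi\in \mathrm L^1(\mathbb H_p^\times,\mu_{\mathbb H_p^\times})$ and $$\int_{\mathrm{SO}(3,\mathbb Q_p)}\phi\,d\mu_3=c\int_{\mathbb H_p^\times}\widehat{\mathscr L}_\psi\phi\;d\mu_{\mathbb H_p^\times}.$$ 4. There is a constant $c'>0$, independent of $\phi$ and of $\psi$, such that for all such $\psi$ and $\phi$ (the lift being read in the coordinates $\varphi$ and extended by $0$ to $x=0$), the integrand on the right below is $\lambda$-integrable and $$\int_{\mathrm{SO}(3,\mathbb Q_p)}\phi\,d\mu_3=c'\int_{\mathbb Q_p^4}\frac{(\widehat{\mathscr L}_\psi\phi)(x)}{|Q_{(4)}(x)|_p^{2}}\,d\lambda(x).$$ -/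

import Mathlib

open MeasureTheory Topology
open scoped Quaternion Matrix

namespace PadicRotation

section Algebra

variable {K : Type*} [Field K]

/-- The reduced norm `q₀² - a q₁² - b q₂² + a b q₃²` as a quadratic form on `K⁴`. For `a = v`,
`b = -p` this is `q₀² - v q₁² + p q₂² - p v q₃²`; for `a = b = -1` it is the sum of four squares. -/
def Q4 (a b : K) (x : Fin 4 → K) : K :=
  x 0 ^ 2 - a * x 1 ^ 2 - b * x 2 ^ 2 + a * b * x 3 ^ 2

/-- The ternary form `x₀² - a x₁² - b x₂²`: it is `x₀² - v x₁² + p x₂²` for `a = v`, `b = -p`, and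
the sum of three squares for `a = b = -1`. -/
def Q3 (a b : K) (x : Fin 3 → K) : K :=
  x 0 ^ 2 - a * x 1 ^ 2 - b * x 2 ^ 2

/-- The matrix of `Q3 a b` in the canonical basis. -/
def formMatrix (a b : K) : Matrix (Fin 3) (Fin 3) K :=
  Matrix.diagonal ![1, -a, -b]

/-- The special orthogonal group of the form `Q3 a b`: matrices `L` of determinant one with
`A = Lᵀ A L`. It carries the topology induced from the space of matrices. -/
def SO3 (a b : K) : Subgroup (Matrix.SpecialLinearGroup (Fin 3) K) where
  carrier := {L | formMatrix a b = (L : Matrix (Fin 3) (Fin 3) K)ᵀ * formMatrix a b * L}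
  one_mem' := by simp
  mul_mem' := by
    intro L M hL hM
    simp only [Set.mem_ofPred_eq] at hL hM ⊢
    rw [Matrix.SpecialLinearGroup.coe_mul, Matrix.transpose_mul]
    calc formMatrix a b = (M : Matrix (Fin 3) (Fin 3) K)ᵀ * formMatrix a b * M := hM
      _ = (M : Matrix (Fin 3) (Fin 3) K)ᵀ *
          ((L : Matrix (Fin 3) (Fin 3) K)ᵀ * formMatrix a b * L) * M := by rw [← hL]
      _ = _ := by simp only [Matrix.mul_assoc]
  inv_mem' := by
    intro L hL
    simp only [Set.mem_ofPred_eq] at hL ⊢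
    have h1 : L.1 * (L⁻¹).1 = 1 := by
      rw [← Matrix.SpecialLinearGroup.coe_mul, mul_inv_cancel, Matrix.SpecialLinearGroup.coe_one]
    have h2 : (L⁻¹).1ᵀ * L.1ᵀ = 1 := by
      rw [← Matrix.transpose_mul, h1, Matrix.transpose_one]
    calc formMatrix a b = ((L⁻¹).1ᵀ * L.1ᵀ) * formMatrix a b * (L.1 * (L⁻¹).1) := by
          rw [h1, h2]; simp
      _ = (L⁻¹).1ᵀ * (L.1ᵀ * formMatrix a b * L.1) * (L⁻¹).1 := by simp only [Matrix.mul_assoc]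
      _ = _ := by rw [← hL]

/-- Coordinates of a quaternion in the basis `1, i, j, k = i j`, where `i² = a`, `j² = b`. -/
def coords (a b : K) (ξ : ℍ[K,a,b]) : Fin 4 → K :=
  QuaternionAlgebra.equivTuple a 0 b ξ

/-- The reduced norm of a quaternion. -/
def nrd (a b : K) (ξ : ℍ[K,a,b]) : K := Q4 a b (coords a b ξ)

theorem nrd_eq (a b : K) (ξ : ℍ[K,a,b]) : nrd a b ξ =
    ξ.re ^ 2 - a * ξ.imI ^ 2 - b * ξ.imJ ^ 2 + a * b * ξ.imK ^ 2 := rfl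

theorem mul_star_eq_nrd (a b : K) (ξ : ℍ[K,a,b]) :
    ξ * star ξ = ((nrd a b ξ : K) : ℍ[K,a,b]) := by
  rw [nrd_eq]
  ext <;> simp only [QuaternionAlgebra.re_mul, QuaternionAlgebra.imI_mul,
    QuaternionAlgebra.imJ_mul, QuaternionAlgebra.imK_mul, QuaternionAlgebra.re_star,
    QuaternionAlgebra.imI_star, QuaternionAlgebra.imJ_star, QuaternionAlgebra.imK_star,
    QuaternionAlgebra.re_coe, QuaternionAlgebra.imI_coe, QuaternionAlgebra.imJ_coe,
    QuaternionAlgebra.imK_coe] <;> ring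

theorem nrd_mul (a b : K) (ξ η : ℍ[K,a,b]) : nrd a b (ξ * η) = nrd a b ξ * nrd a b η := by
  simp [nrd_eq]; ring

theorem nrd_one (a b : K) : nrd a b 1 = 1 := by
  simp [nrd_eq]

theorem nrd_unit_ne_zero (a b : K) (ξ : ℍ[K,a,b]ˣ) : nrd a b ξ ≠ 0 := by
  intro h
  have h1 := nrd_mul a b ξ (ξ⁻¹ : ℍ[K,a,b]ˣ)
  rw [Units.mul_inv, nrd_one, h, zero_mul] at h1
  exact one_ne_zero h1

theorem inv_eq (a b : K) (ξ : ℍ[K,a,b]ˣ) :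
    ((ξ⁻¹ : ℍ[K,a,b]ˣ) : ℍ[K,a,b]) = (nrd a b ξ)⁻¹ • star (ξ : ℍ[K,a,b]) := by
  refine Units.inv_eq_of_mul_eq_one_right ?_
  rw [mul_smul_comm, mul_star_eq_nrd, QuaternionAlgebra.smul_coe,
    inv_mul_cancel₀ (nrd_unit_ne_zero a b ξ), QuaternionAlgebra.coe_one]

/-- The space of pure imaginary quaternions. -/
def pureQuat (a b : K) : Submodule K ℍ[K,a,b] :=
  LinearMap.ker (QuaternionAlgebra.reₗ a 0 b)

theorem mem_pureQuat (a b : K) (ν : ℍ[K,a,b]) : ν ∈ pureQuat a b ↔ ν.re = 0 := Iff.rfl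

theorem re_mul_comm (a b : K) (ξ η : ℍ[K,a,b]) : (ξ * η).re = (η * ξ).re := by
  simp; ring

/-- Conjugation `ν ↦ ξ ν ξ⁻¹` by an invertible quaternion on the pure imaginary quaternions. -/
def conj (a b : K) (ξ : ℍ[K,a,b]ˣ) : pureQuat a b →ₗ[K] pureQuat a b where
  toFun ν := ⟨ξ * ν * (ξ⁻¹ : ℍ[K,a,b]ˣ), by
    rw [mem_pureQuat, re_mul_comm, Units.inv_mul_cancel_left]
    exact ν.2⟩
  map_add' ν ρ := by
    ext1
    simp [mul_add, add_mul]
  map_smul' c ν := by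
    ext1
    simp

theorem conj_mul (a b : K) (ξ η : ℍ[K,a,b]ˣ) : conj a b (ξ * η) = conj a b ξ ∘ₗ conj a b η := by
  refine LinearMap.ext fun ν => Subtype.ext ?_
  simp [conj, mul_assoc]

theorem conj_one (a b : K) : conj a b 1 = LinearMap.id := by
  refine LinearMap.ext fun ν => Subtype.ext ?_
  simp [conj]

theorem nrd_conj (a b : K) (ξ : ℍ[K,a,b]ˣ) (ν : pureQuat a b) :
    nrd a b (conj a b ξ ν : ℍ[K,a,b]) = nrd a b (ν : ℍ[K,a,b]) := by
  have h := nrd_mul a b ξ (ξ⁻¹ : ℍ[K,a,b]ˣ)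
  rw [Units.mul_inv, nrd_one] at h
  change nrd a b (ξ * ν * (ξ⁻¹ : ℍ[K,a,b]ˣ)) = _
  rw [nrd_mul, nrd_mul]
  linear_combination (-nrd a b (ν : ℍ[K,a,b])) * h

/-- The coordinates `(s₁, s₂, s₃) ↦ i s₁ + j s₂ + k s₃` on the pure imaginary quaternions. -/
def ijk (a b : K) : (Fin 3 → K) ≃ₗ[K] pureQuat a b where
  toFun s := ⟨⟨0, s 0, s 1, s 2⟩, rfl⟩
  invFun ν := ![(ν : ℍ[K,a,b]).imI, (ν : ℍ[K,a,b]).imJ, (ν : ℍ[K,a,b]).imK]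
  left_inv s := by
    ext i
    fin_cases i <;> rfl
  right_inv ν := by
    ext
    · exact ν.2.symm
    all_goals rfl
  map_add' s t := by
    ext <;> simp
  map_smul' c s := by
    ext <;> simp

theorem det_conj (a b : K) (ξ : ℍ[K,a,b]ˣ) : LinearMap.det (conj a b ξ) = 1 := by
  have hN := nrd_unit_ne_zero a b ξ
  rw [← LinearMap.det_conj (conj a b ξ) (ijk a b).symm, ← LinearMap.det_toMatrix',
    Matrix.det_fin_three]
  simp only [LinearMap.toMatrix'_apply, LinearMap.comp_apply, conj, ijk, inv_eq]
  simp
  rw [nrd_eq] at *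
  field_simp
  ring

/-- An identification of the quadratic space `(K³, Q3 a b)` with the space of pure imaginary
quaternions with the reduced norm, up to a non-zero scaling of the form. -/
structure Frame (a b : K) where
  equiv : (Fin 3 → K) ≃ₗ[K] pureQuat a b
  similar : ∃ c : K, c ≠ 0 ∧ ∀ x, nrd a b (equiv x : ℍ[K,a,b]) = c * Q3 a b x

/-- The identification `x ↦ k x₀ + a j x₁ - b i x₂`, which scales the form by `a b`. -/
def Frame.standard (a b : K) (ha : a ≠ 0) (hb : b ≠ 0) : Frame a b where
  equiv :=
    { toFun := fun x => ⟨⟨0, -b * x 2, a * x 1, x 0⟩, rfl⟩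
      invFun := fun ν => ![(ν : ℍ[K,a,b]).imK, a⁻¹ * (ν : ℍ[K,a,b]).imJ,
        -b⁻¹ * (ν : ℍ[K,a,b]).imI]
      left_inv := by
        intro x
        ext i
        fin_cases i <;> simp [ha, hb]
      right_inv := by
        intro ν
        ext
        · exact ν.2.symm
        all_goals simp [ha, hb]
      map_add' := by
        intro x y
        ext <;> simp <;> ring
      map_smul' := by
        intro c x
        ext <;> simp <;> ring }
  similar := ⟨a * b, mul_ne_zero ha hb, fun x => by
    rw [nrd_eq, Q3]
    simp
    ring⟩

/-- For `a = b = -1` the coordinates `i s₁ + j s₂ + k s₃` are such an identification. -/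
def Frame.hamilton : Frame (-1 : K) (-1) where
  equiv := ijk (-1) (-1)
  similar := ⟨1, one_ne_zero, fun x => by
    rw [nrd_eq, Q3]
    simp [ijk]⟩

/-- The bilinear form of `Q3 a b`. -/
def B3 (a b : K) (x y : Fin 3 → K) : K := x 0 * y 0 - a * (x 1 * y 1) - b * (x 2 * y 2)

theorem two_mul_B3 (a b : K) (x y : Fin 3 → K) :
    2 * B3 a b x y = Q3 a b (x + y) - Q3 a b x - Q3 a b y := by
  simp [B3, Q3]; ring

/-- The linear map `ν ↦ ξ ν ξ⁻¹` transported to `K³`. -/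
def rotLin {a b : K} (e : Frame a b) (ξ : ℍ[K,a,b]ˣ) : (Fin 3 → K) →ₗ[K] (Fin 3 → K) :=
  (e.equiv.symm : pureQuat a b →ₗ[K] (Fin 3 → K)) ∘ₗ conj a b ξ ∘ₗ
    (e.equiv : (Fin 3 → K) →ₗ[K] pureQuat a b)

theorem Q3_rotLin {a b : K} (e : Frame a b) (ξ : ℍ[K,a,b]ˣ) (x : Fin 3 → K) :
    Q3 a b (rotLin e ξ x) = Q3 a b x := by
  obtain ⟨c, hc, h⟩ := e.similar
  apply mul_left_cancel₀ hc
  rw [← h, ← h, ← nrd_conj a b ξ (e.equiv x)]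
  simp [rotLin]

theorem B3_rotLin [CharZero K] {a b : K} (e : Frame a b) (ξ : ℍ[K,a,b]ˣ) (x y : Fin 3 → K) :
    B3 a b (rotLin e ξ x) (rotLin e ξ y) = B3 a b x y := by
  apply mul_left_cancel₀ (two_ne_zero (α := K))
  rw [two_mul_B3, two_mul_B3, ← map_add, Q3_rotLin, Q3_rotLin, Q3_rotLin]

theorem det_rotLin {a b : K} (e : Frame a b) (ξ : ℍ[K,a,b]ˣ) :
    (LinearMap.toMatrix' (rotLin e ξ)).det = 1 := by
  rw [LinearMap.det_toMatrix', ← det_conj a b ξ, ← LinearMap.det_conj (conj a b ξ) e.equiv.symm]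
  rfl

theorem formMatrix_rotLin [CharZero K] {a b : K} (e : Frame a b) (ξ : ℍ[K,a,b]ˣ) :
    formMatrix a b = (LinearMap.toMatrix' (rotLin e ξ))ᵀ * formMatrix a b *
      LinearMap.toMatrix' (rotLin e ξ) := by
  have h1 : ∀ (M : Matrix (Fin 3) (Fin 3) K) (i j : Fin 3), (Mᵀ * formMatrix a b * M) i j =
      B3 a b (fun k => M k i) (fun k => M k j) := by
    intro M i j
    simp [formMatrix, B3, Matrix.mul_apply, Fin.sum_univ_three, Matrix.diagonal_apply]
    ring
  ext i j
  have h2 := h1 1 i j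
  simp only [Matrix.transpose_one, one_mul, mul_one] at h2
  rw [h1, h2, ← LinearMap.toMatrix'_id]
  simp only [LinearMap.toMatrix'_apply]
  exact (B3_rotLin e ξ _ _).symm

/-- The homomorphism `Hˣ → SO(3)`, `ξ ↦ (ν ↦ ξ ν ξ⁻¹)`, written as a matrix through `e`. It is the
quotient map `q : Hˣ → Hˣ / Kˣ` followed by the identification `Hˣ / Kˣ ≅ SO(3)`. -/
def rot [CharZero K] {a b : K} (e : Frame a b) : ℍ[K,a,b]ˣ →* SO3 a b where
  toFun ξ := ⟨⟨LinearMap.toMatrix' (rotLin e ξ), det_rotLin e ξ⟩, formMatrix_rotLin e ξ⟩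
  map_one' := by
    apply Subtype.ext
    apply Subtype.ext
    change LinearMap.toMatrix' (rotLin e 1) = 1
    rw [← LinearMap.toMatrix'_id]
    congr 1
    ext : 2
    simp [rotLin, conj_one]
  map_mul' ξ η := by
    apply Subtype.ext
    apply Subtype.ext
    change LinearMap.toMatrix' (rotLin e (ξ * η)) =
      LinearMap.toMatrix' (rotLin e ξ) * LinearMap.toMatrix' (rotLin e η)
    rw [← LinearMap.toMatrix'_comp]
    congr 1
    refine LinearMap.ext fun x => ?_
    simp [rotLin, conj_mul]

/-- The embedding `Kˣ → Hˣ` of the non-zero scalars. -/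
def scalar (a b : K) : Kˣ →* ℍ[K,a,b]ˣ :=
  Units.map (algebraMap K ℍ[K,a,b] : K →* ℍ[K,a,b])

end Algebra

section Measure

variable {p : ℕ} [Fact p.Prime]

/-- The parameters of the `p`-adic quaternion algebra: `i² = v`, `j² = -p` with `v` a non-square
unit for odd `p`, and `i² = j² = -1` for `p = 2`. -/
def IsStandardPair (a b : ℚ_[p]) : Prop :=
  (p ≠ 2 ∧ ‖a‖ = 1 ∧ ¬ IsSquare a ∧ b = -(p : ℚ_[p])) ∨ (p = 2 ∧ a = -1 ∧ b = -1)

noncomputable instance : MeasurableSpace ℚ_[p] := borel _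

instance : BorelSpace ℚ_[p] := ⟨rfl⟩

/-- The topology of `ℚ_p⁴` on the quaternions. -/
noncomputable instance (a b : ℚ_[p]) : TopologicalSpace ℍ[ℚ_[p],a,b] :=
  TopologicalSpace.induced (coords a b) inferInstance

theorem isInducing_coords (a b : ℚ_[p]) : IsInducing (coords a b) := ⟨rfl⟩

theorem continuous_coords (a b : ℚ_[p]) (i : Fin 4) :
    Continuous fun ξ : ℍ[ℚ_[p],a,b] => coords a b ξ i :=
  (continuous_apply i).comp (isInducing_coords a b).continuous

theorem continuous_re (a b : ℚ_[p]) : Continuous fun ξ : ℍ[ℚ_[p],a,b] => ξ.re :=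
  continuous_coords a b 0

theorem continuous_imI (a b : ℚ_[p]) : Continuous fun ξ : ℍ[ℚ_[p],a,b] => ξ.imI :=
  continuous_coords a b 1

theorem continuous_imJ (a b : ℚ_[p]) : Continuous fun ξ : ℍ[ℚ_[p],a,b] => ξ.imJ :=
  continuous_coords a b 2

theorem continuous_imK (a b : ℚ_[p]) : Continuous fun ξ : ℍ[ℚ_[p],a,b] => ξ.imK :=
  continuous_coords a b 3

theorem continuous_quat {a b : ℚ_[p]} {X : Type*} [TopologicalSpace X] {f : X → ℍ[ℚ_[p],a,b]}
    (h0 : Continuous fun x => (f x).re) (h1 : Continuous fun x => (f x).imI)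
    (h2 : Continuous fun x => (f x).imJ) (h3 : Continuous fun x => (f x).imK) :
    Continuous f := by
  rw [(isInducing_coords a b).continuous_iff]
  refine continuous_pi fun i => ?_
  fin_cases i
  · exact h0
  · exact h1
  · exact h2
  · exact h3

instance (a b : ℚ_[p]) : IsTopologicalRing ℍ[ℚ_[p],a,b] where
  continuous_add := by
    have h0 := continuous_re a b
    have h1 := continuous_imI a b
    have h2 := continuous_imJ a b
    have h3 := continuous_imK a b
    apply continuous_quat <;> simp only [QuaternionAlgebra.re_add, QuaternionAlgebra.imI_add,
      QuaternionAlgebra.imJ_add, QuaternionAlgebra.imK_add] <;> fun_prop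
  continuous_mul := by
    have h0 := continuous_re a b
    have h1 := continuous_imI a b
    have h2 := continuous_imJ a b
    have h3 := continuous_imK a b
    apply continuous_quat <;> simp only [QuaternionAlgebra.re_mul, QuaternionAlgebra.imI_mul,
      QuaternionAlgebra.imJ_mul, QuaternionAlgebra.imK_mul] <;> fun_prop
  continuous_neg := by
    have h0 := continuous_re a b
    have h1 := continuous_imI a b
    have h2 := continuous_imJ a b
    have h3 := continuous_imK a b
    apply continuous_quat <;> simp only [QuaternionAlgebra.re_neg, QuaternionAlgebra.imI_neg,
      QuaternionAlgebra.imJ_neg, QuaternionAlgebra.imK_neg] <;> fun_prop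

noncomputable instance (a b : ℚ_[p]) : MeasurableSpace ℍ[ℚ_[p],a,b] := borel _

instance (a b : ℚ_[p]) : BorelSpace ℍ[ℚ_[p],a,b] := ⟨rfl⟩

/-- The group of invertible quaternions carries the topology induced from the quaternions. -/
theorem isEmbedding_units (a b : ℚ_[p]) :
    IsEmbedding (Units.val : ℍ[ℚ_[p],a,b]ˣ → ℍ[ℚ_[p],a,b]) := by
  refine Units.isEmbedding_val_mk' (f := fun ξ => (nrd a b ξ)⁻¹ • star ξ) ?_
    (fun u => (inv_eq a b u).symm)
  have h0 := continuous_re a b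
  have h1 := continuous_imI a b
  have h2 := continuous_imJ a b
  have h3 := continuous_imK a b
  have hn : Continuous fun ξ : {ξ : ℍ[ℚ_[p],a,b] | IsUnit ξ} => (nrd a b ξ.1)⁻¹ := by
    refine Continuous.inv₀ ?_ ?_
    · simp only [nrd_eq]
      fun_prop
    · rintro ⟨_, u, rfl⟩
      exact nrd_unit_ne_zero a b u
  rw [continuousOn_iff_continuous_domRestrict]
  apply continuous_quat <;> simp <;> fun_prop

/-- The Borel sets of the group of invertible quaternions are the traces of those of `H`. -/
instance (a b : ℚ_[p]) : BorelSpace ℍ[ℚ_[p],a,b]ˣ :=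
  ⟨by rw [(isEmbedding_units a b).eq_induced, borel_comap]; rfl⟩

instance : BorelSpace ℚ_[p]ˣ :=
  ⟨by rw [(Units.isEmbedding_val₀ (G₀ := ℚ_[p])).eq_induced, borel_comap]; rfl⟩

noncomputable instance (a b : ℚ_[p]) : MeasurableSpace (SO3 a b) := borel _

instance (a b : ℚ_[p]) : BorelSpace (SO3 a b) := ⟨rfl⟩

variable (p) in
/-- The ring of `p`-adic integers as a compact neighbourhood of zero in `ℚ_p`. -/
noncomputable def unitBall : TopologicalSpace.PositiveCompacts ℚ_[p] where
  carrier := Metric.closedBall 0 1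
  isCompact' := isCompact_closedBall 0 1
  interior_nonempty' := ⟨0, mem_interior_iff_mem_nhds.mpr (Metric.closedBall_mem_nhds 0 one_pos)⟩

variable (p) in
/-- The Haar measure of `ℚ_p` that gives `ℤ_p` mass one. -/
noncomputable def lambda : Measure ℚ_[p] := Measure.addHaarMeasure (unitBall p)

variable (p) in
/-- The Haar measure of `ℚ_p⁴`, the product of four copies of `lambda p`. -/
noncomputable def lambda4 : Measure (Fin 4 → ℚ_[p]) := Measure.pi fun _ => lambda p

/-- The coordinates of an invertible quaternion. -/
noncomputable def unitCoords (a b : ℚ_[p]) (ξ : ℍ[ℚ_[p],a,b]ˣ) : Fin 4 → ℚ_[p] := coords a b ξ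

/-- The measure `E ↦ ∫_{φ(E)} |Q4(x)|_p⁻² dλ(x)` on the group of invertible quaternions, where `φ`
is the coordinate map. -/
noncomputable def quatHaar (a b : ℚ_[p]) : Measure ℍ[ℚ_[p],a,b]ˣ :=
  ((lambda4 p).withDensity fun x => (‖Q4 a b x‖ₑ ^ 2)⁻¹).comap (unitCoords a b)

/-- The integral `∫ ψ(ξ z) dμ(z)` over the coset `ξ ℚ_pˣ`, i.e. the value of `P ψ` at that coset. -/
noncomputable def fiberIntegral {a b : ℚ_[p]} (μ : Measure ℚ_[p]ˣ) (ψ : ℍ[ℚ_[p],a,b]ˣ → ℝ)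
    (ξ : ℍ[ℚ_[p],a,b]ˣ) : ℝ :=
  ∫ z, ψ (ξ * scalar a b z) ∂μ

/-- The set `Ψ`: non-zero, non-negative, continuous, compactly supported functions on `Hˣ` whose
integral over every coset of `ℚ_pˣ` is one. -/
structure IsWeight {a b : ℚ_[p]} (μ : Measure ℚ_[p]ˣ) (ψ : ℍ[ℚ_[p],a,b]ˣ → ℝ) : Prop where
  continuous : Continuous ψ
  hasCompactSupport : HasCompactSupport ψ
  nonneg : ∀ ξ, 0 ≤ ψ ξ
  ne_zero : ψ ≠ 0
  fiberIntegral_eq_one : ∀ ξ, fiberIntegral μ ψ ξ = 1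

/-- The extended Weil-Mackey-Bruhat lift `ψ · (φ ∘ q)` of a function on `SO(3)`. -/
noncomputable def wmbLift {a b : ℚ_[p]} (e : Frame a b) (ψ : ℍ[ℚ_[p],a,b]ˣ → ℝ)
    (φ : SO3 a b → ℂ) (ξ : ℍ[ℚ_[p],a,b]ˣ) : ℂ :=
  (ψ ξ : ℂ) * φ (rot e ξ)

end Measure

end PadicRotation

/-!
The quaternion algebra `H` is a division algebra, that is, `Q4` is anisotropic (`Q4_anisotropic`):
for odd `p` because `x² - v y²` has absolute value `max (|x|, |y|)²` by Hensel's lemma, so that the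
two halves of `Q4` have valuations of different parity; for `p = 2` because `-1` is not a sum of
three squares modulo `8`. As a consequence the sets `|nrd| ≤ r` are compact, and the shell
`p⁻¹ ≤ |nrd| ≤ 1` is a compact open subset of `Hˣ` meeting each coset of the scalars in a coset of
`ℤ_pˣ`. Its normalized indicator function is a weight (`exists_isWeight`).

Left multiplication by `ξ` scales the additive Haar measure of `H` by `|nrd ξ|²`
(`distribHaarChar_quat`): the factor is trivial on the elements with `|nrd| = 1`, which preserve a
set of positive finite measure, and it is known for scalars; now `ξ²` and the scalar `nrd ξ` have
the same norm. Hence `|nrd|⁻² dλ` is left invariant (`isHaarMeasure_quatHaar`).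

The homomorphism `rot : Hˣ → SO(3)` is onto (`rot_surjective`): in a division algebra an isometry
of determinant one can be undone on `i` and then on `j` by explicit conjugations, and what remains
is the identity. For a weight `ψ` let `ν_ψ` be the image of `ψ dμ_H` under `rot`. A Fubini argument
shows that `ν_ψ` does not depend on `ψ` (`IsWeight.lintegral_mul_eq`). A left translate of `ν_ψ` by
`rot η` is `ν` of a translate of `ψ`, so that `ν_ψ` is left invariant. It is finite and non-zero on
the compact group `SO(3)`, hence a Haar measure, and the integral formulas are the uniqueness of
Haar measure.
-/

namespace PadicRotation

/-! ### Conjugations exhaust the rotation group -/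

section Surjectivity

variable {K : Type*} [Field K] {a b : K}

theorem exists_unit_of_nrd_ne_zero {ξ : ℍ[K,a,b]} (h : nrd a b ξ ≠ 0) :
    ∃ u : ℍ[K,a,b]ˣ, (u : ℍ[K,a,b]) = ξ := by
  refine ⟨⟨ξ, (nrd a b ξ)⁻¹ • star ξ, ?_, ?_⟩, rfl⟩
  · rw [mul_smul_comm, mul_star_eq_nrd, QuaternionAlgebra.smul_coe, inv_mul_cancel₀ h,
      QuaternionAlgebra.coe_one]
  · have hs : nrd a b (star ξ) = nrd a b ξ := by simp [nrd_eq]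
    have := mul_star_eq_nrd a b (star ξ)
    rw [star_star, hs] at this
    rw [smul_mul_assoc, this, QuaternionAlgebra.smul_coe, inv_mul_cancel₀ h,
      QuaternionAlgebra.coe_one]

theorem pure_mul_self {ν : ℍ[K,a,b]} (h : ν.re = 0) : ν * ν = ((-nrd a b ν : K) : ℍ[K,a,b]) := by
  rw [nrd_eq]
  ext <;> simp only [QuaternionAlgebra.re_mul, QuaternionAlgebra.imI_mul,
    QuaternionAlgebra.imJ_mul, QuaternionAlgebra.imK_mul, QuaternionAlgebra.re_coe,
    QuaternionAlgebra.imI_coe, QuaternionAlgebra.imJ_coe, QuaternionAlgebra.imK_coe, h] <;> ring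

/-- A linear endomorphism of the pure imaginary quaternions preserving the norm preserves
`re (ν ρ)`, which is minus the bilinear form of the norm. -/
theorem re_mul_eq_of_nrd_eq [CharZero K] {N : pureQuat a b →ₗ[K] pureQuat a b}
    (hN : ∀ ν, nrd a b (N ν : ℍ[K,a,b]) = nrd a b (ν : ℍ[K,a,b])) (ν ρ : pureQuat a b) :
    ((N ν : ℍ[K,a,b]) * N ρ).re = ((ν : ℍ[K,a,b]) * ρ).re := by
  have key : ∀ ν ρ : pureQuat a b, 2 * ((ν : ℍ[K,a,b]) * ρ).re =
      nrd a b (ν : ℍ[K,a,b]) + nrd a b (ρ : ℍ[K,a,b]) -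
        nrd a b ((ν + ρ : pureQuat a b) : ℍ[K,a,b]) := by
    rintro ⟨ν, hν⟩ ⟨ρ, hρ⟩
    rw [mem_pureQuat] at hν hρ
    simp [nrd_eq, hν, hρ]
    ring
  apply mul_left_cancel₀ (two_ne_zero (α := K))
  rw [key, key, ← map_add, hN, hN, hN]

theorem conj_apply_eq_iff (ξ : ℍ[K,a,b]ˣ) (ν ρ : pureQuat a b) :
    conj a b ξ ν = ρ ↔ (ξ * ν : ℍ[K,a,b]) = ρ * ξ := by
  rw [Subtype.ext_iff]
  exact Units.mul_inv_eq_iff_eq_mul ξ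

theorem conj_inv_comp_conj (ξ : ℍ[K,a,b]ˣ) : conj a b ξ ∘ₗ conj a b ξ⁻¹ = LinearMap.id := by
  rw [← conj_mul, mul_inv_cancel, conj_one]

variable (a b) in
/-- The quaternion `i`. -/
def qi : pureQuat a b := ⟨⟨0, 1, 0, 0⟩, rfl⟩

variable (a b) in
/-- The quaternion `j`. -/
def qj : pureQuat a b := ⟨⟨0, 0, 1, 0⟩, rfl⟩

variable (a b) in
/-- The quaternion `k`. -/
def qk : pureQuat a b := ⟨⟨0, 0, 0, 1⟩, rfl⟩

theorem nrd_qi : nrd a b (qi a b : ℍ[K,a,b]) = -a := by simp [nrd_eq, qi]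

theorem nrd_qj : nrd a b (qj a b : ℍ[K,a,b]) = -b := by simp [nrd_eq, qj]

theorem ne_zero_of_anisotropic (h0 : ∀ ξ : ℍ[K,a,b], nrd a b ξ = 0 → ξ = 0) : a ≠ 0 ∧ b ≠ 0 := by
  constructor <;> rintro rfl
  · have := h0 _ (nrd_qi.trans neg_zero)
    simpa [qi] using congrArg (·.imI) this
  · have := h0 _ (nrd_qj.trans neg_zero)
    simpa [qj] using congrArg (·.imJ) this

/-- In a division algebra, a pure quaternion with the same square as `i` is conjugate to `i`:
`w ξ = ξ i` for `ξ = w i + a`, and `j` does the job if this `ξ` vanishes, that is if `w = -i`. -/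
theorem exists_conj_qi_eq (h0 : ∀ ξ : ℍ[K,a,b], nrd a b ξ = 0 → ξ = 0) (w : pureQuat a b)
    (hw : nrd a b (w : ℍ[K,a,b]) = -a) : ∃ ξ : ℍ[K,a,b]ˣ, conj a b ξ (qi a b) = w := by
  have hww := pure_mul_self w.2
  rw [hw, neg_neg] at hww
  have hii : (qi a b : ℍ[K,a,b]) * qi a b = (a : ℍ[K,a,b]) := by
    rw [pure_mul_self (qi a b).2, nrd_qi, neg_neg]
  obtain ⟨ha, hb⟩ := ne_zero_of_anisotropic h0
  by_cases hξ : (w : ℍ[K,a,b]) * qi a b + (a : ℍ[K,a,b]) = 0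
  · obtain ⟨u, hu⟩ := exists_unit_of_nrd_ne_zero (a := a) (b := b) (ξ := qj a b)
      (by rw [nrd_qj]; exact neg_ne_zero.2 hb)
    have hwi : (w : ℍ[K,a,b]) = -qi a b := by
      have h1 : a • (w : ℍ[K,a,b]) = a • (-qi a b : ℍ[K,a,b]) := by
        have := congrArg (· * (qi a b : ℍ[K,a,b])) hξ
        simp only [add_mul, mul_assoc, hii, zero_mul] at this
        rw [QuaternionAlgebra.mul_coe_eq_smul, QuaternionAlgebra.coe_mul_eq_smul] at this
        rw [smul_neg]
        exact eq_neg_of_add_eq_zero_left this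
      exact smul_right_injective _ ha h1
    refine ⟨u, (conj_apply_eq_iff _ _ _).2 ?_⟩
    rw [hu, hwi]
    ext <;> simp [qi, qj]
  · obtain ⟨u, hu⟩ := exists_unit_of_nrd_ne_zero (mt (h0 _) hξ)
    refine ⟨u, (conj_apply_eq_iff _ _ _).2 ?_⟩
    rw [hu, add_mul, mul_add, mul_assoc, hii, ← mul_assoc, hww, add_comm,
      QuaternionAlgebra.mul_coe_eq_smul]

/-- Within the centralizer of `i`, the same formula carries `j` to every `w` orthogonal to `i` with
the same square as `j`. -/
theorem exists_conj_qj_eq (h0 : ∀ ξ : ℍ[K,a,b], nrd a b ξ = 0 → ξ = 0) (w : pureQuat a b)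
    (hw : nrd a b (w : ℍ[K,a,b]) = -b) (hI : (w : ℍ[K,a,b]).imI = 0) :
    ∃ ξ : ℍ[K,a,b]ˣ, conj a b ξ (qi a b) = qi a b ∧ conj a b ξ (qj a b) = w := by
  have hww := pure_mul_self w.2
  rw [hw, neg_neg] at hww
  have hjj : (qj a b : ℍ[K,a,b]) * qj a b = (b : ℍ[K,a,b]) := by
    rw [pure_mul_self (qj a b).2, nrd_qj, neg_neg]
  obtain ⟨ha, hb⟩ := ne_zero_of_anisotropic h0
  by_cases hξ : (w : ℍ[K,a,b]) * qj a b + (b : ℍ[K,a,b]) = 0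
  · -- In this case `w = -j`, and conjugation by `i` maps `j` to `-j`.
    obtain ⟨u, hu⟩ := exists_unit_of_nrd_ne_zero (a := a) (b := b) (ξ := qi a b)
      (by rw [nrd_qi]; exact neg_ne_zero.2 ha)
    have hwj : (w : ℍ[K,a,b]) = -qj a b := by
      have h1 : b • (w : ℍ[K,a,b]) = b • (-qj a b : ℍ[K,a,b]) := by
        have := congrArg (· * (qj a b : ℍ[K,a,b])) hξ
        simp only [add_mul, mul_assoc, hjj, zero_mul] at this
        rw [QuaternionAlgebra.mul_coe_eq_smul, QuaternionAlgebra.coe_mul_eq_smul] at this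
        rw [smul_neg]
        exact eq_neg_of_add_eq_zero_left this
      exact smul_right_injective _ hb h1
    refine ⟨u, (conj_apply_eq_iff _ _ _).2 (by rw [hu]), (conj_apply_eq_iff _ _ _).2 ?_⟩
    rw [hu, hwj]
    ext <;> simp [qi, qj]
  · obtain ⟨u, hu⟩ := exists_unit_of_nrd_ne_zero (mt (h0 _) hξ)
    refine ⟨u, (conj_apply_eq_iff _ _ _).2 ?_, (conj_apply_eq_iff _ _ _).2 ?_⟩
    · have hre : (w : ℍ[K,a,b]).re = 0 := w.2
      rw [hu]
      ext <;> simp [qi, qj, hI, hre]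
    · rw [hu, add_mul, mul_add, mul_assoc, hjj, ← mul_assoc, hww, add_comm,
        QuaternionAlgebra.mul_coe_eq_smul]

theorem eq_id_of_fixes_qi_qj [CharZero K] (ha : a ≠ 0) (hb : b ≠ 0)
    {N : pureQuat a b →ₗ[K] pureQuat a b}
    (hN : ∀ ν, nrd a b (N ν : ℍ[K,a,b]) = nrd a b (ν : ℍ[K,a,b])) (hdet : LinearMap.det N = 1)
    (hi : N (qi a b) = qi a b) (hj : N (qj a b) = qj a b) : N = LinearMap.id := by
  have h1 : ((N (qk a b) : ℍ[K,a,b])).imI = 0 := by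
    have := re_mul_eq_of_nrd_eq hN (qi a b) (qk a b)
    rw [hi] at this
    simpa [qi, qk, ha] using this
  have h2 : ((N (qk a b) : ℍ[K,a,b])).imJ = 0 := by
    have := re_mul_eq_of_nrd_eq hN (qj a b) (qk a b)
    rw [hj] at this
    simpa [qj, qk, hb] using this
  have e0 : ijk a b (Pi.single 0 1) = qi a b := by ext <;> simp [ijk, qi]
  have e1 : ijk a b (Pi.single 1 1) = qj a b := by ext <;> simp [ijk, qj]
  have e2 : ijk a b (Pi.single 2 1) = qk a b := by ext <;> simp [ijk, qk]
  have h3 : ((N (qk a b) : ℍ[K,a,b])).imK = 1 := by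
    rw [← LinearMap.det_conj N (ijk a b).symm, ← LinearMap.det_toMatrix',
      Matrix.det_fin_three] at hdet
    simp only [LinearMap.toMatrix'_apply, LinearMap.comp_apply, LinearEquiv.coe_coe,
      LinearEquiv.symm_symm, e0, e1, e2, hi, hj] at hdet
    simpa [ijk, qi, qj, h1, h2] using hdet
  have hk : N (qk a b) = qk a b := by
    have h0 : (N (qk a b) : ℍ[K,a,b]).re = 0 := (N (qk a b)).2
    ext
    exacts [h0, h1, h2, h3]
  have : N ∘ₗ (ijk a b : (Fin 3 → K) →ₗ[K] pureQuat a b) = (ijk a b) := by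
    refine LinearMap.pi_ext' fun i => LinearMap.ext_ring ?_
    fin_cases i
    · simpa [e0] using hi
    · simpa [e1] using hj
    · simpa [e2] using hk
  refine LinearMap.ext fun ν => ?_
  simpa using LinearMap.congr_fun this ((ijk a b).symm ν)

/-- Every isometry of determinant one of the pure imaginary quaternions is a conjugation: conjugate
`i` to its image, then `j` to its image while fixing `i`; the rest is the identity. -/
theorem exists_conj_eq [CharZero K] (h0 : ∀ ξ : ℍ[K,a,b], nrd a b ξ = 0 → ξ = 0)
    (N : pureQuat a b →ₗ[K] pureQuat a b)
    (hN : ∀ ν, nrd a b (N ν : ℍ[K,a,b]) = nrd a b (ν : ℍ[K,a,b])) (hdet : LinearMap.det N = 1) :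
    ∃ ξ : ℍ[K,a,b]ˣ, conj a b ξ = N := by
  obtain ⟨ha, hb⟩ := ne_zero_of_anisotropic h0
  obtain ⟨ξ, hξ⟩ := exists_conj_qi_eq h0 (N (qi a b)) (by rw [hN, nrd_qi])
  have cancel : ∀ (η : ℍ[K,a,b]ˣ) ν, conj a b η⁻¹ (conj a b η ν) = ν := fun η ν => by
    rw [← LinearMap.comp_apply, ← conj_mul, inv_mul_cancel, conj_one, LinearMap.id_apply]
  set N₁ := conj a b ξ⁻¹ ∘ₗ N with hN₁
  have h1 : ∀ ν, nrd a b (N₁ ν : ℍ[K,a,b]) = nrd a b (ν : ℍ[K,a,b]) := fun ν => by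
    rw [hN₁, LinearMap.comp_apply, nrd_conj, hN]
  have h1i : N₁ (qi a b) = qi a b := by rw [hN₁, LinearMap.comp_apply, ← hξ, cancel]
  obtain ⟨η, hηi, hηj⟩ := exists_conj_qj_eq h0 (N₁ (qj a b)) (by rw [h1, nrd_qj]) (by
    have := re_mul_eq_of_nrd_eq h1 (qi a b) (qj a b)
    rw [h1i] at this
    simpa [qi, qj, ha] using this)
  have h2 : conj a b η⁻¹ ∘ₗ N₁ = LinearMap.id := by
    refine eq_id_of_fixes_qi_qj ha hb (fun ν => ?_) ?_ ?_ ?_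
    · rw [LinearMap.comp_apply, nrd_conj, h1]
    · rw [LinearMap.det_comp, LinearMap.det_comp, det_conj, det_conj, hdet, one_mul, one_mul]
    · rw [LinearMap.comp_apply, h1i]
      nth_rw 1 [← hηi]
      exact cancel _ _
    · rw [LinearMap.comp_apply, ← hηj, cancel]
  refine ⟨ξ * η, ?_⟩
  have h3 : conj a b η = N₁ := by
    rw [← LinearMap.comp_id (conj a b η), ← h2, ← LinearMap.comp_assoc, conj_inv_comp_conj,
      LinearMap.id_comp]
  rw [conj_mul, h3, hN₁, ← LinearMap.comp_assoc, conj_inv_comp_conj, LinearMap.id_comp]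

theorem Q3_mulVec (L : SO3 a b) (x : Fin 3 → K) :
    Q3 a b ((L.1 : Matrix (Fin 3) (Fin 3) K) *ᵥ x) = Q3 a b x := by
  have hQ : ∀ x : Fin 3 → K, Q3 a b x = x ⬝ᵥ (formMatrix a b *ᵥ x) := fun x => by
    simp [Q3, formMatrix, dotProduct, Fin.sum_univ_three, Matrix.mulVec_diagonal]
    ring
  have hL : (L.1 : Matrix (Fin 3) (Fin 3) K)ᵀ * formMatrix a b * L.1 = formMatrix a b :=
    (show formMatrix a b = _ from L.2).symm
  rw [hQ x, ← hL, hQ, Matrix.mul_assoc, ← Matrix.mulVec_mulVec, ← Matrix.mulVec_mulVec,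
    Matrix.dotProduct_mulVec x, Matrix.vecMul_transpose]

theorem rot_surjective [CharZero K] (h0 : ∀ ξ : ℍ[K,a,b], nrd a b ξ = 0 → ξ = 0)
    (e : Frame a b) : Function.Surjective (rot e) := by
  intro L
  obtain ⟨c, hc, h⟩ := e.similar
  let N : pureQuat a b →ₗ[K] pureQuat a b :=
    (e.equiv : (Fin 3 → K) →ₗ[K] pureQuat a b) ∘ₗ
      Matrix.toLin' (L.1 : Matrix (Fin 3) (Fin 3) K) ∘ₗ
      (e.equiv.symm : pureQuat a b →ₗ[K] (Fin 3 → K))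
  obtain ⟨ξ, hξ⟩ := exists_conj_eq h0 N (fun ν => by
    have h2 := h (e.equiv.symm ν)
    rw [LinearEquiv.apply_symm_apply] at h2
    rw [h2, ← Q3_mulVec L, ← h]
    rfl) (by
    have := LinearMap.det_conj (Matrix.toLin' (L.1 : Matrix (Fin 3) (Fin 3) K)) e.equiv
    rw [LinearMap.det_toLin', L.1.2] at this
    exact this)
  refine ⟨ξ, Subtype.ext (Subtype.ext ?_)⟩
  change LinearMap.toMatrix' (rotLin e ξ) = _
  rw [← LinearEquiv.eq_symm_apply]
  refine LinearMap.ext fun x => ?_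
  simp [rotLin, hξ, N]

theorem rot_mul_scalar [CharZero K] (e : Frame a b) (ξ : ℍ[K,a,b]ˣ) (z : Kˣ) :
    rot e (ξ * scalar a b z) = rot e ξ := by
  have h : conj a b (scalar a b z) = LinearMap.id := LinearMap.ext fun ν => by
    rw [conj_apply_eq_iff]
    exact Algebra.commutes (z : K) (ν : ℍ[K,a,b])
  refine Subtype.ext (Subtype.ext ?_)
  change LinearMap.toMatrix' (rotLin e _) = LinearMap.toMatrix' (rotLin e ξ)
  rw [rotLin, conj_mul, h, LinearMap.comp_id, rotLin]

theorem scalar_comm (ξ : ℍ[K,a,b]ˣ) (z : Kˣ) : ξ * scalar a b z = scalar a b z * ξ :=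
  Units.ext (Algebra.commutes (z : K) (ξ : ℍ[K,a,b])).symm

theorem nrd_scalar (z : Kˣ) : nrd a b (scalar a b z : ℍ[K,a,b]) = (z : K) ^ 2 := by
  simp [scalar, nrd_eq, QuaternionAlgebra.algebraMap_eq]

end Surjectivity

/-! ### Anisotropy of the norm form -/

section Anisotropy

variable {p : ℕ} [Fact p.Prime]

/-- By Hensel's lemma a unit of `ℤ_p`, `p` odd, that is a square modulo `p` is a square. -/
theorem norm_sq_sub_eq_one (hp : p ≠ 2) {v x : ℚ_[p]} (hv : ‖v‖ = 1) (hsq : ¬ IsSquare v)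
    (hx : ‖x‖ = 1) : ‖x ^ 2 - v‖ = 1 := by
  by_contra hne
  have hle : ‖x ^ 2 - v‖ ≤ 1 := by
    have := Padic.nonarchimedean (x ^ 2) (-v)
    rwa [← sub_eq_add_neg, norm_neg, hv, norm_pow, hx, one_pow, max_self] at this
  have hlt := lt_of_le_of_ne hle hne
  let v' : ℤ_[p] := ⟨v, hv.le⟩
  let x' : ℤ_[p] := ⟨x, hx.le⟩
  have h2 : ‖(2 : ℤ_[p])‖ = 1 := by
    have : ((2 : ℕ) : ℤ_[p]) = 2 := by norm_num
    rw [← this, PadicInt.norm_natCast_eq_one_iff]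
    exact (Nat.coprime_primes (Fact.out) Nat.prime_two).2 hp
  obtain ⟨z, hz, -⟩ := hensels_lemma (p := p) (R := ℤ_[p])
    (F := (Polynomial.X ^ 2 - Polynomial.C v' : Polynomial ℤ_[p])) (a := x') (by
      have h1 : ‖x' ^ 2 - v'‖ < 1 := hlt
      have h3 : ‖x'‖ = 1 := hx
      simpa [h2, h3, one_add_one_eq_two] using h1)
  apply hsq
  refine ⟨z, ?_⟩
  have : z ^ 2 = v' := by simpa [sub_eq_zero] using hz
  rw [← sq]
  exact_mod_cast (congrArg (Subtype.val) this).symm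

theorem norm_sq_sub_mul_sq (hp : p ≠ 2) {v : ℚ_[p]} (hv : ‖v‖ = 1) (hsq : ¬ IsSquare v)
    (x y : ℚ_[p]) : ‖x ^ 2 - v * y ^ 2‖ = max ‖x‖ ‖y‖ ^ 2 := by
  by_cases hxy : ‖x‖ = ‖y‖
  · rcases eq_or_ne y 0 with rfl | hy
    · rw [norm_zero, norm_eq_zero] at hxy
      simp [hxy]
    · have h1 := norm_sq_sub_eq_one hp hv hsq (x := x / y) (by
        rw [norm_div, hxy, div_self (norm_ne_zero_iff.2 hy)])
      have h2 : x ^ 2 - v * y ^ 2 = y ^ 2 * ((x / y) ^ 2 - v) := by field_simp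
      rw [h2, norm_mul, h1, hxy, max_self, mul_one, norm_pow]
  · have hne : ‖x ^ 2‖ ≠ ‖-(v * y ^ 2)‖ := by
      rw [norm_neg, norm_mul, hv, one_mul, norm_pow, norm_pow]
      exact fun h => hxy ((sq_eq_sq₀ (norm_nonneg _) (norm_nonneg _)).1 h)
    rw [sub_eq_add_neg, Padic.add_eq_max_of_ne hne, norm_neg, norm_mul, hv, one_mul,
      norm_pow, norm_pow]
    rcases le_total ‖x‖ ‖y‖ with h | h
    · rw [max_eq_right h, max_eq_right (pow_le_pow_left₀ (norm_nonneg _) h 2)]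
    · rw [max_eq_left h, max_eq_left (pow_le_pow_left₀ (norm_nonneg _) h 2)]

/-- The valuations of `s²` and `p t²` have different parities. -/
theorem eq_zero_of_norm_sq_eq {s t : ℚ_[p]} (h : ‖s‖ ^ 2 = ‖(p : ℚ_[p])‖ * ‖t‖ ^ 2) : t = 0 := by
  by_contra ht
  have hp0 : (p : ℚ_[p]) ≠ 0 := by exact_mod_cast (Fact.out : p.Prime).ne_zero
  have hs : s ≠ 0 := by
    rintro rfl
    rw [norm_zero, zero_pow two_ne_zero, eq_comm, mul_eq_zero, norm_eq_zero] at h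
    simp [hp0, ht] at h
  have h1 : (1 : ℝ) < p := by exact_mod_cast (Fact.out : p.Prime).one_lt
  have h0 : (p : ℝ) ≠ 0 := by positivity
  rw [Padic.norm_eq_zpow_neg_valuation hs, Padic.norm_eq_zpow_neg_valuation ht, Padic.norm_p,
    ← zpow_natCast, ← zpow_natCast, ← zpow_mul, ← zpow_mul, ← zpow_neg_one, ← zpow_add₀ h0] at h
  have := zpow_right_injective₀ (by positivity) h1.ne' h
  push_cast at this
  omega

/-- Minus one is not a sum of three squares modulo `8`. -/
theorem one_add_three_sq_ne_zero {x y z : ℚ_[2]} (hx : ‖x‖ ≤ 1) (hy : ‖y‖ ≤ 1) (hz : ‖z‖ ≤ 1) :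
    1 + x ^ 2 + y ^ 2 + z ^ 2 ≠ 0 := by
  intro h
  let x' : ℤ_[2] := ⟨x, hx⟩
  let y' : ℤ_[2] := ⟨y, hy⟩
  let z' : ℤ_[2] := ⟨z, hz⟩
  have h' : 1 + x' ^ 2 + y' ^ 2 + z' ^ 2 = 0 := Subtype.ext h
  have h2 := congrArg (PadicInt.toZModPow (p := 2) 3) h'
  simp only [map_add, map_pow, map_one, map_zero] at h2
  have key : ∀ x y z : ZMod 8, 1 + x ^ 2 + y ^ 2 + z ^ 2 ≠ 0 := by decide
  exact key _ _ _ h2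

theorem sum_four_sq_anisotropic (x : Fin 4 → ℚ_[2])
    (h : x 0 ^ 2 + x 1 ^ 2 + x 2 ^ 2 + x 3 ^ 2 = 0) : x = 0 := by
  obtain ⟨i, hi⟩ := Finite.exists_max fun i => ‖x i‖
  by_contra hx
  have h0 : x i ≠ 0 := by
    intro h0
    refine hx (funext fun j => ?_)
    simpa [h0] using hi j
  have hd : ∀ j, ‖x j / x i‖ ≤ 1 := fun j => by
    rw [norm_div]
    exact div_le_one_of_le₀ (hi j) (norm_nonneg _)
  fin_cases i
  · refine one_add_three_sq_ne_zero (hd 1) (hd 2) (hd 3) ?_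
    field_simp
    simp only [Fin.zero_eta]
    linear_combination h
  · refine one_add_three_sq_ne_zero (hd 0) (hd 2) (hd 3) ?_
    field_simp
    simp only [Fin.mk_one]
    linear_combination h
  · refine one_add_three_sq_ne_zero (hd 0) (hd 1) (hd 3) ?_
    field_simp
    simp only [Fin.reduceFinMk]
    linear_combination h
  · refine one_add_three_sq_ne_zero (hd 0) (hd 1) (hd 2) ?_
    field_simp
    simp only [Fin.reduceFinMk]
    linear_combination h

theorem Q4_anisotropic {a b : ℚ_[p]} (hab : IsStandardPair a b) {x : Fin 4 → ℚ_[p]}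
    (hx : Q4 a b x = 0) : x = 0 := by
  rcases hab with ⟨hp, ha, hsq, rfl⟩ | ⟨rfl, rfl, rfl⟩
  · have hmax : ∀ y z : ℚ_[p], ∃ s : ℚ_[p], max ‖y‖ ‖z‖ = ‖s‖ := fun y z =>
      (max_choice ‖y‖ ‖z‖).elim (fun h => ⟨y, h⟩) fun h => ⟨z, h⟩
    obtain ⟨s, hs⟩ := hmax (x 0) (x 1)
    obtain ⟨t, ht⟩ := hmax (x 2) (x 3)
    have h1 : x 0 ^ 2 - a * x 1 ^ 2 = -(p * (x 2 ^ 2 - a * x 3 ^ 2)) := by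
      rw [Q4] at hx
      linear_combination hx
    have h2 := congrArg norm h1
    rw [norm_neg, norm_mul, norm_sq_sub_mul_sq hp ha hsq, norm_sq_sub_mul_sq hp ha hsq, hs,
      ht] at h2
    have ht0 := eq_zero_of_norm_sq_eq h2
    have hs0 : s = 0 := by simpa [ht0] using h2
    have e0 : ‖x 0‖ ≤ 0 := (le_max_left _ _).trans (by rw [hs, hs0, norm_zero])
    have e1 : ‖x 1‖ ≤ 0 := (le_max_right _ _).trans (by rw [hs, hs0, norm_zero])
    have e2 : ‖x 2‖ ≤ 0 := (le_max_left _ _).trans (by rw [ht, ht0, norm_zero])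
    have e3 : ‖x 3‖ ≤ 0 := (le_max_right _ _).trans (by rw [ht, ht0, norm_zero])
    ext i : 1
    fin_cases i
    exacts [norm_le_zero_iff.1 e0, norm_le_zero_iff.1 e1, norm_le_zero_iff.1 e2,
      norm_le_zero_iff.1 e3]
  · apply sum_four_sq_anisotropic
    rw [Q4] at hx
    linear_combination hx

theorem eq_zero_of_nrd_eq_zero {a b : ℚ_[p]} (h0 : ∀ x, Q4 a b x = 0 → x = 0)
    {ξ : ℍ[ℚ_[p],a,b]} (h : nrd a b ξ = 0) : ξ = 0 :=
  (QuaternionAlgebra.equivTuple a 0 b).injective <| (h0 _ h).trans <| by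
    ext i : 1
    fin_cases i <;> rfl

theorem continuous_Q4 (a b : ℚ_[p]) : Continuous (Q4 a b) := by
  unfold Q4
  fun_prop

theorem Q4_smul (a b t : ℚ_[p]) (x : Fin 4 → ℚ_[p]) : Q4 a b (t • x) = t ^ 2 * Q4 a b x := by
  simp only [Q4, Pi.smul_apply, smul_eq_mul]
  ring

/-- By compactness of the unit sphere an anisotropic form is bounded below by a multiple of the
square of the norm. -/
theorem exists_mul_norm_sq_le_norm_Q4 {a b : ℚ_[p]} (h0 : ∀ x, Q4 a b x = 0 → x = 0) :
    ∃ c : ℝ, 0 < c ∧ ∀ x, c * ‖x‖ ^ 2 ≤ ‖Q4 a b x‖ := by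
  have hne : (Metric.sphere (0 : Fin 4 → ℚ_[p]) 1).Nonempty := ⟨fun _ => 1, by simp⟩
  obtain ⟨y, hy, hmin⟩ := (isCompact_sphere (0 : Fin 4 → ℚ_[p]) 1).exists_isMinOn hne
    (continuous_Q4 a b).norm.continuousOn
  refine ⟨‖Q4 a b y‖, norm_pos_iff.2 fun h => ?_, fun x => ?_⟩
  · simp [h0 y h] at hy
  · obtain ⟨i, hi⟩ := Finite.exists_max fun i => ‖x i‖
    have hxi : ‖x‖ = ‖x i‖ := le_antisymm ((pi_norm_le_iff_of_nonneg (norm_nonneg _)).2 hi)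
      (norm_le_pi_norm x i)
    rcases eq_or_ne (x i) 0 with h | h
    · simp [hxi, h]
    · have hn : ‖x i‖ ≠ 0 := norm_ne_zero_iff.2 h
      have := hmin (show (x i)⁻¹ • x ∈ Metric.sphere 0 1 by
        rw [mem_sphere_zero_iff_norm, norm_smul, norm_inv, hxi, inv_mul_cancel₀ hn])
      simp only [Set.mem_ofPred_eq] at this
      rw [Q4_smul, norm_mul, norm_pow, norm_inv] at this
      rw [hxi]
      calc ‖Q4 a b y‖ * ‖x i‖ ^ 2 ≤ (‖x i‖⁻¹ ^ 2 * ‖Q4 a b x‖) * ‖x i‖ ^ 2 := by gcongr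
        _ = ‖Q4 a b x‖ := by field_simp

theorem isCompact_setOf_norm_Q4_le {a b : ℚ_[p]} (h0 : ∀ x, Q4 a b x = 0 → x = 0) (r : ℝ) :
    IsCompact {x | ‖Q4 a b x‖ ≤ r} := by
  obtain ⟨c, hc, h⟩ := exists_mul_norm_sq_le_norm_Q4 h0
  refine Metric.isCompact_of_isClosed_isBounded
    (isClosed_le (continuous_Q4 a b).norm continuous_const) ?_
  refine (Metric.isBounded_closedBall (x := (0 : Fin 4 → ℚ_[p])) (r := √(r / c))).subset
    fun x hx => ?_
  rw [mem_closedBall_zero_iff]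
  refine Real.le_sqrt_of_sq_le ?_
  rw [le_div_iff₀ hc, mul_comm]
  exact (h x).trans hx

end Anisotropy

/-! ### Scaling of the Haar measure of `ℚ_p` -/

section PadicBall

variable {p : ℕ} [Fact p.Prime]

open scoped Pointwise NNReal

instance : (lambda p).IsAddHaarMeasure := by unfold lambda; infer_instance

instance : (lambda p).Regular := by unfold lambda; infer_instance

theorem lambda_closedBall_one : lambda p (Metric.closedBall 0 1) = 1 :=
  Measure.addHaarMeasure_self (K₀ := unitBall p)

theorem smul_closedBall_one (z : ℚ_[p]ˣ) :
    z • Metric.closedBall (0 : ℚ_[p]) 1 = Metric.closedBall 0 ‖(z : ℚ_[p])‖ := by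
  ext x
  have hz : 0 < ‖(z : ℚ_[p])‖ := norm_pos_iff.2 z.ne_zero
  rw [Set.mem_smul_set_iff_inv_smul_mem, mem_closedBall_zero_iff, mem_closedBall_zero_iff,
    Units.smul_def, Units.val_inv_eq_inv_val, smul_eq_mul, norm_mul, norm_inv,
    inv_mul_le_iff₀ hz, mul_one]

/-- `ℤ_p` is the disjoint union of the `p` cosets of `p ℤ_p`. -/
theorem natCast_mul_lambda_closedBall_norm_p :
    (p : ENNReal) * lambda p (Metric.closedBall 0 ‖(p : ℚ_[p])‖) = 1 := by
  have hp : p.Prime := Fact.out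
  have hdecomp : Metric.closedBall (0 : ℚ_[p]) 1 =
      ⋃ i ∈ Finset.range p, Metric.closedBall (i : ℚ_[p]) ‖(p : ℚ_[p])‖ := by
    ext x
    simp only [Set.mem_iUnion, Finset.mem_range, exists_prop, mem_closedBall_iff_norm,
      sub_zero]
    constructor
    · intro (hx : ‖x‖ ≤ 1)
      obtain ⟨n, hn, h⟩ := PadicInt.exists_mem_range (⟨x, hx⟩ : ℤ_[p])
      refine ⟨n, hn, ?_⟩
      rw [PadicInt.maximalIdeal_eq_span_p, Ideal.mem_span_singleton] at h
      obtain ⟨y, hy⟩ := h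
      have h2 : x - n = p * (y : ℚ_[p]) := by
        have h3 : ((⟨x, hx⟩ - (n : ℤ_[p]) : ℤ_[p]) : ℚ_[p]) = ((p * y : ℤ_[p]) : ℚ_[p]) :=
          congrArg _ hy
        push_cast at h3
        exact h3
      rw [h2, norm_mul]
      exact mul_le_of_le_one_right (norm_nonneg _) y.2
    · rintro ⟨n, -, h⟩
      have h1 := Padic.nonarchimedean (x - (n : ℚ_[p])) (n : ℚ_[p])
      rw [sub_add_cancel] at h1
      refine h1.trans (max_le (h.trans ?_) ?_)
      · exact Padic.norm_p_lt_one.le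
      · exact_mod_cast Padic.norm_int_le_one n
  have hdisj : (Finset.range p : Set ℕ).PairwiseDisjoint
      fun i : ℕ => Metric.closedBall (i : ℚ_[p]) ‖(p : ℚ_[p])‖ := by
    intro i hi j hj hij
    rw [Finset.coe_range, Set.mem_Iio] at hi hj
    refine Set.disjoint_left.2 fun x hxi hxj => hij ?_
    rw [mem_closedBall_iff_norm] at hxi hxj
    have h1 := Padic.nonarchimedean (x - (j : ℚ_[p])) (-(x - (i : ℚ_[p])))
    rw [norm_neg] at h1
    have h2 : ‖(((i : ℤ) - j : ℤ) : ℚ_[p])‖ < 1 := by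
      have : (((i : ℤ) - j : ℤ) : ℚ_[p]) = x - j + -(x - i) := by push_cast; ring
      rw [this]
      exact (h1.trans (max_le hxj hxi)).trans_lt Padic.norm_p_lt_one
    rw [Padic.norm_intCast_lt_one_iff] at h2
    have h3 := Int.eq_zero_of_abs_lt_dvd h2 (by rw [abs_lt]; omega)
    omega
  have h1 := lambda_closedBall_one (p := p)
  rw [hdecomp, measure_biUnion_finset hdisj fun i _ => measurableSet_closedBall] at h1
  rw [← h1]
  have : ∀ i : ℕ, lambda p (Metric.closedBall (i : ℚ_[p]) ‖(p : ℚ_[p])‖) =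
      lambda p (Metric.closedBall 0 ‖(p : ℚ_[p])‖) := fun i => by
    rw [← measure_preimage_add_right (lambda p) (i : ℚ_[p]) (Metric.closedBall _ _)]
    congr 1
    ext x
    simp
  rw [Finset.sum_congr rfl fun i _ => this i, Finset.sum_const, Finset.card_range, nsmul_eq_mul]

theorem distribHaarChar_padic (z : ℚ_[p]ˣ) : distribHaarChar ℚ_[p] z = ‖(z : ℚ_[p])‖₊ := by
  have hp : p.Prime := Fact.out
  have hp0 : (p : ℚ_[p]) ≠ 0 := by exact_mod_cast hp.ne_zero
  have hunit : ∀ u : ℚ_[p]ˣ, ‖(u : ℚ_[p])‖ = 1 → distribHaarChar ℚ_[p] u = 1 := fun u hu => by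
    refine distribHaarChar_eq_of_measure_smul_eq_mul (μ := lambda p)
      (s := Metric.closedBall 0 1) ?_ ?_ ?_
    · simp [lambda_closedBall_one]
    · simp [lambda_closedBall_one]
    · rw [smul_closedBall_one, hu]
      simp
  have hpp : distribHaarChar ℚ_[p] (Units.mk0 (p : ℚ_[p]) hp0) = ‖(p : ℚ_[p])‖₊ := by
    refine distribHaarChar_eq_of_measure_smul_eq_mul (μ := lambda p)
      (s := Metric.closedBall 0 1) ?_ ?_ ?_
    · simp [lambda_closedBall_one]
    · simp [lambda_closedBall_one]
    · rw [smul_closedBall_one, lambda_closedBall_one, mul_one, Units.val_mk0]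
      have h1 := natCast_mul_lambda_closedBall_norm_p (p := p)
      rw [mul_comm] at h1
      rw [ENNReal.eq_inv_of_mul_eq_one_left h1]
      have h2 : ‖(p : ℚ_[p])‖₊ = (p : ℝ≥0)⁻¹ := by
        ext
        simp
      rw [h2, ENNReal.coe_inv (by exact_mod_cast hp.ne_zero), ENNReal.coe_natCast]
  -- The modulus is multiplicative, and `z` is a unit of `ℤ_p` times a power of `p`.
  set π := Units.mk0 (p : ℚ_[p]) hp0 with hπ
  set n := (z : ℚ_[p]).valuation with hn
  have hz : ‖(z : ℚ_[p])‖ = ‖(p : ℚ_[p])‖ ^ n := by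
    rw [Padic.norm_eq_zpow_neg_valuation z.ne_zero, Padic.norm_p, inv_zpow, zpow_neg]
  have hu := hunit (z * (π ^ n)⁻¹) (by
    simp only [Units.val_mul, Units.val_inv_eq_inv_val, Units.val_zpow_eq_zpow_val, norm_mul,
      norm_inv, norm_zpow, hπ, Units.val_mk0]
    rw [← hz, mul_inv_cancel₀ (norm_ne_zero_iff.2 z.ne_zero)])
  rw [map_mul, map_inv, map_zpow, hpp] at hu
  rw [mul_inv_eq_one₀ (zpow_ne_zero _ (nnnorm_ne_zero_iff.2 hp0))] at hu
  rw [hu]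
  ext
  simp [hz]

theorem lambda_closedBall_norm (z : ℚ_[p]ˣ) :
    lambda p (Metric.closedBall 0 ‖(z : ℚ_[p])‖) = ‖(z : ℚ_[p])‖₊ := by
  rw [← smul_closedBall_one, ← distribHaarChar_mul, lambda_closedBall_one, mul_one,
    distribHaarChar_padic]

end PadicBall

/-! ### Topology of the invertible quaternions -/

section QuaternionTopology

variable {p : ℕ} [Fact p.Prime] (a b : ℚ_[p])

/-- The coordinate map as an isomorphism of topological groups. -/
noncomputable def coordsEquiv : ℍ[ℚ_[p],a,b] ≃ₜ+ (Fin 4 → ℚ_[p]) :=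
  { (QuaternionAlgebra.equivTuple a 0 b).toHomeomorphOfIsInducing (isInducing_coords a b) with
    map_add' := fun x y => by
      ext i
      fin_cases i <;> rfl }

instance : T2Space ℍ[ℚ_[p],a,b] := (coordsEquiv a b).toHomeomorph.isEmbedding.t2Space

instance : SecondCountableTopology ℍ[ℚ_[p],a,b] :=
  (coordsEquiv a b).toHomeomorph.secondCountableTopology

instance : LocallyCompactSpace ℍ[ℚ_[p],a,b] :=
  (coordsEquiv a b).toHomeomorph.isClosedEmbedding.locallyCompactSpace

theorem continuous_nrd : Continuous (nrd a b) :=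
  (continuous_Q4 a b).comp (isInducing_coords a b).continuous

theorem isOpenEmbedding_units :
    IsOpenEmbedding (Units.val : ℍ[ℚ_[p],a,b]ˣ → ℍ[ℚ_[p],a,b]) := by
  refine ⟨isEmbedding_units a b, ?_⟩
  have : Set.range (Units.val : ℍ[ℚ_[p],a,b]ˣ → ℍ[ℚ_[p],a,b]) = {ξ | nrd a b ξ ≠ 0} := by
    ext ξ
    exact ⟨fun ⟨u, hu⟩ => hu ▸ nrd_unit_ne_zero a b u, exists_unit_of_nrd_ne_zero⟩
  rw [this]
  exact isOpen_ne_fun (continuous_nrd a b) continuous_const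

theorem isOpenEmbedding_unitCoords : IsOpenEmbedding (unitCoords a b) :=
  (coordsEquiv a b).toHomeomorph.isOpenEmbedding.comp (isOpenEmbedding_units a b)

theorem measurableEmbedding_unitCoords : MeasurableEmbedding (unitCoords a b) :=
  (isOpenEmbedding_unitCoords a b).measurableEmbedding

theorem Q4_unitCoords (ξ : ℍ[ℚ_[p],a,b]ˣ) : Q4 a b (unitCoords a b ξ) = nrd a b ξ := rfl

instance : SecondCountableTopology ℍ[ℚ_[p],a,b]ˣ :=
  (isEmbedding_units a b).secondCountableTopology

instance : LocallyCompactSpace ℍ[ℚ_[p],a,b]ˣ :=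
  (isOpenEmbedding_units a b).locallyCompactSpace

/-- The open set of invertible quaternions with norm of absolute value `1` or `p⁻¹`. It meets every
coset of the non-zero scalars, in a coset of the units of `ℤ_p`. -/
def shell : Set ℍ[ℚ_[p],a,b]ˣ := {ξ | (p : ℝ)⁻¹ ≤ ‖nrd a b ξ‖ ∧ ‖nrd a b ξ‖ ≤ 1}

theorem isClopen_shell : IsClopen (shell a b) := by
  have h : shell a b = (fun ξ : ℍ[ℚ_[p],a,b]ˣ => nrd a b ξ) ⁻¹'
      ((Metric.ball 0 (p : ℝ)⁻¹)ᶜ ∩ Metric.closedBall 0 1) := by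
    ext ξ
    simp [shell]
  rw [h]
  refine IsClopen.preimage ?_ ((continuous_nrd a b).comp Units.continuous_val)
  exact (IsUltrametricDist.isClopen_ball _ _).compl.inter
    (IsUltrametricDist.isClopen_closedBall _ one_ne_zero)

theorem one_mem_shell : (1 : ℍ[ℚ_[p],a,b]ˣ) ∈ shell a b := by
  have : (1 : ℝ) ≤ p := by exact_mod_cast (Fact.out : p.Prime).one_lt.le
  simp only [shell, Set.mem_ofPred_eq, Units.val_one, nrd_one, norm_one, le_refl, and_true]
  exact inv_le_one_of_one_le₀ this

variable {a b}

theorem isCompact_shell (h0 : ∀ x, Q4 a b x = 0 → x = 0) : IsCompact (shell a b) := by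
  rw [(isOpenEmbedding_unitCoords a b).isEmbedding.isCompact_iff]
  have h : unitCoords a b '' shell a b =
      {x | ‖Q4 a b x‖ ≤ 1} ∩ {x | (p : ℝ)⁻¹ ≤ ‖Q4 a b x‖} := by
    ext x
    constructor
    · rintro ⟨ξ, ⟨h1, h2⟩, rfl⟩
      exact ⟨h2, h1⟩
    · rintro ⟨h1, h2⟩
      obtain ⟨η, rfl⟩ := (coordsEquiv a b).surjective x
      have hη : nrd a b η ≠ 0 := by
        intro hη
        have h3 : (p : ℝ)⁻¹ ≤ ‖nrd a b η‖ := h2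
        rw [hη, norm_zero, inv_nonpos] at h3
        exact (Fact.out : p.Prime).ne_zero (by exact_mod_cast h3.antisymm p.cast_nonneg)
      obtain ⟨u, rfl⟩ := exists_unit_of_nrd_ne_zero hη
      exact ⟨u, ⟨h2, h1⟩, rfl⟩
  rw [h]
  exact (isCompact_setOf_norm_Q4_le h0 1).inter_right
    (isClosed_le continuous_const (continuous_Q4 a b).norm)

end QuaternionTopology

/-! ### Haar measure of the invertible quaternions -/

section HaarMeasure

variable {p : ℕ} [Fact p.Prime] (a b : ℚ_[p])

open scoped Pointwise NNReal ENNReal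

instance : (lambda4 p).IsAddHaarMeasure := by unfold lambda4; infer_instance

/-- The additive Haar measure on the quaternions read off the coordinates. -/
noncomputable def addHaarQuat : Measure ℍ[ℚ_[p],a,b] := (lambda4 p).map (coordsEquiv a b).symm

instance : (addHaarQuat a b).IsAddHaarMeasure := by unfold addHaarQuat; infer_instance

theorem addHaarQuat_apply (s : Set ℍ[ℚ_[p],a,b]) :
    addHaarQuat a b s = lambda4 p (coordsEquiv a b '' s) := by
  have : addHaarQuat a b = (lambda4 p).map (coordsEquiv a b).toHomeomorph.symm.toMeasurableEquiv :=
    rfl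
  rw [this, MeasurableEquiv.map_apply]
  congr 1
  exact ((coordsEquiv a b).toEquiv.image_eq_preimage_symm s).symm

theorem lambda4_pi_closedBall (z : ℚ_[p]ˣ) :
    lambda4 p (Set.univ.pi fun _ => Metric.closedBall 0 ‖(z : ℚ_[p])‖) = ‖(z : ℚ_[p])‖₊ ^ 4 := by
  rw [lambda4, Measure.pi_pi]
  simp [lambda_closedBall_norm]

theorem distribHaarChar_scalar (z : ℚ_[p]ˣ) :
    distribHaarChar ℍ[ℚ_[p],a,b] (scalar a b z) = ‖(z : ℚ_[p])‖₊ ^ 4 := by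
  have h1 := lambda4_pi_closedBall (1 : ℚ_[p]ˣ)
  simp only [Units.val_one, norm_one, nnnorm_one, ENNReal.coe_one, one_pow] at h1
  have h2 : addHaarQuat a b
      (coordsEquiv a b ⁻¹' Set.univ.pi fun _ => Metric.closedBall 0 1) = 1 := by
    rw [addHaarQuat_apply, Set.image_preimage_eq _ (coordsEquiv a b).surjective, h1]
  refine distribHaarChar_eq_of_measure_smul_eq_mul (μ := addHaarQuat a b)
    (s := coordsEquiv a b ⁻¹' Set.univ.pi fun _ => Metric.closedBall 0 1) ?_ ?_ ?_
  · simp [h2]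
  · simp [h2]
  · rw [h2, mul_one, addHaarQuat_apply, ENNReal.coe_pow, ← lambda4_pi_closedBall]
    congr 1
    have hs : ∀ ξ : ℍ[ℚ_[p],a,b], coordsEquiv a b (scalar a b z • ξ) = z • coordsEquiv a b ξ := by
      intro ξ
      have : scalar a b z • ξ = (z : ℚ_[p]) • ξ := (Algebra.smul_def _ _).symm
      rw [this]
      ext i
      fin_cases i <;> rfl
    rw [← Set.image_smul, Set.image_image, Set.image_congr fun ξ _ => hs ξ,
      ← Set.image_image (z • ·) (coordsEquiv a b), Set.image_smul,
      Set.image_preimage_eq _ (coordsEquiv a b).surjective]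
    ext x
    simp only [Set.mem_smul_set_iff_inv_smul_mem, Set.mem_univ_pi, Pi.smul_apply,
      ← smul_closedBall_one]

variable {a b}

/-- Left multiplication by `ξ` scales the additive Haar measure by `|nrd ξ|²`. When `|nrd ξ| = 1`
the multiplication preserves the open set `|nrd| < 2`, which has finite measure since `|nrd| ≤ 2` is
compact; the general case follows since `ξ²` and the scalar `nrd ξ` have the same norm. -/
theorem distribHaarChar_quat (h0 : ∀ x, Q4 a b x = 0 → x = 0) (ξ : ℍ[ℚ_[p],a,b]ˣ) :
    distribHaarChar ℍ[ℚ_[p],a,b] ξ = ‖nrd a b ξ‖₊ ^ 2 := by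
  have hunit : ∀ ξ : ℍ[ℚ_[p],a,b]ˣ, ‖nrd a b ξ‖ = 1 → distribHaarChar ℍ[ℚ_[p],a,b] ξ = 1 := by
    intro ξ hξ
    have hopen : IsOpen {η : ℍ[ℚ_[p],a,b] | ‖nrd a b η‖ < 2} :=
      isOpen_lt (continuous_nrd a b).norm continuous_const
    have hcomp : IsCompact {η : ℍ[ℚ_[p],a,b] | ‖nrd a b η‖ ≤ 2} :=
      (coordsEquiv a b).toHomeomorph.isClosedEmbedding.isCompact_preimage
        (isCompact_setOf_norm_Q4_le h0 2)
    refine distribHaarChar_eq_of_measure_smul_eq_mul (μ := addHaarQuat a b)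
      (s := {η | ‖nrd a b η‖ < 2}) ?_ ?_ ?_
    · exact (hopen.measure_pos _ ⟨0, by simp [nrd_eq]⟩).ne'
    · exact ((measure_mono fun η (h : ‖nrd a b η‖ < 2) => h.le).trans_lt
        hcomp.measure_lt_top).ne
    · rw [ENNReal.coe_one, one_mul]
      congr 1
      ext η
      have h1 : nrd a b ((ξ⁻¹ : ℍ[ℚ_[p],a,b]ˣ) : ℍ[ℚ_[p],a,b]) * nrd a b ξ = 1 := by
        rw [← nrd_mul, Units.inv_mul, nrd_one]
      have h2 := congrArg norm h1
      rw [norm_mul, hξ, mul_one, norm_one] at h2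
      rw [Set.mem_smul_set_iff_inv_smul_mem, Units.smul_def, smul_eq_mul, Set.mem_ofPred_eq,
        nrd_mul, norm_mul, h2, one_mul, Set.mem_ofPred_eq]
  let z := Units.mk0 (nrd a b ξ) (nrd_unit_ne_zero a b ξ)
  have h1 : nrd a b ((scalar a b z)⁻¹ : ℍ[ℚ_[p],a,b]ˣ) *
      nrd a b (scalar a b z : ℍ[ℚ_[p],a,b]) = 1 := by
    rw [← nrd_mul, Units.inv_mul, nrd_one]
  have h2 := hunit ((scalar a b z)⁻¹ * ξ ^ 2) (by
    rw [nrd_scalar] at h1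
    rw [Units.val_mul, Units.val_pow_eq_pow_val, nrd_mul, sq, nrd_mul, ← sq]
    rw [show nrd a b (ξ : ℍ[ℚ_[p],a,b]) = z from rfl, h1, norm_one])
  rw [map_mul, map_inv, map_pow, distribHaarChar_scalar,
    inv_mul_eq_one₀ (pow_ne_zero _ (nnnorm_ne_zero_iff.2 z.ne_zero))] at h2
  have h3 : (‖(z : ℚ_[p])‖₊ ^ 2) ^ 2 = (distribHaarChar ℍ[ℚ_[p],a,b] ξ) ^ 2 := by
    rw [← h2]; ring
  exact ((sq_eq_sq₀ zero_le zero_le).1 h3).symm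

variable (a b) in
/-- The restriction of the additive Haar measure to the invertible quaternions. -/
noncomputable def addHaarUnits : Measure ℍ[ℚ_[p],a,b]ˣ := (lambda4 p).comap (unitCoords a b)

theorem addHaarUnits_apply (E : Set ℍ[ℚ_[p],a,b]ˣ) :
    addHaarUnits a b E = lambda4 p (unitCoords a b '' E) :=
  (measurableEmbedding_unitCoords a b).comap_apply _ _

theorem map_mul_left_addHaarUnits (h0 : ∀ x, Q4 a b x = 0 → x = 0) (ξ : ℍ[ℚ_[p],a,b]ˣ) :
    ‖nrd a b ξ‖ₑ ^ 2 • (addHaarUnits a b).map (ξ * ·) = addHaarUnits a b := by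
  ext E hE
  have h1 : ∀ F : Set ℍ[ℚ_[p],a,b]ˣ,
      addHaarUnits a b F = addHaarQuat a b (Units.val '' F) := fun F => by
    rw [addHaarUnits_apply, addHaarQuat_apply, Set.image_image]
    rfl
  rw [Measure.smul_apply, Measure.map_apply (measurable_const_mul ξ) hE, h1, h1, smul_eq_mul]
  have h2 : (Units.val '' E : Set ℍ[ℚ_[p],a,b]) = ξ • (Units.val '' ((ξ * ·) ⁻¹' E)) := by
    rw [← Set.image_smul, Set.image_image]
    have : (fun η : ℍ[ℚ_[p],a,b]ˣ => ξ • (η : ℍ[ℚ_[p],a,b])) = fun η => Units.val (ξ * η) := rfl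
    rw [this, ← Set.image_image Units.val (ξ * ·),
      Set.image_preimage_eq _ (Group.mulLeft_bijective ξ).surjective]
  rw [h2, ← distribHaarChar_mul, distribHaarChar_quat h0]
  rfl

theorem measurable_nrd_unit : Measurable fun ξ : ℍ[ℚ_[p],a,b]ˣ => nrd a b ξ :=
  ((continuous_nrd a b).comp Units.continuous_val).measurable

theorem quatHaar_eq_withDensity : quatHaar a b =
    (addHaarUnits a b).withDensity fun ξ => (‖nrd a b ξ‖ₑ ^ 2)⁻¹ := by
  have hj := measurableEmbedding_unitCoords a b
  ext E hE
  have hE' := hj.measurableSet_image.2 hE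
  have h1 := hj.restrict_map (addHaarUnits a b) (unitCoords a b '' E)
  rw [hj.injective.preimage_image, addHaarUnits, hj.map_comap, Measure.restrict_restrict hE',
    Set.inter_eq_left.2 (Set.image_subset_range _ _)] at h1
  rw [quatHaar, hj.comap_apply, withDensity_apply _ hE', withDensity_apply _ hE, h1,
    hj.lintegral_map]
  rfl

theorem map_mul_left_quatHaar (h0 : ∀ x, Q4 a b x = 0 → x = 0) (ξ : ℍ[ℚ_[p],a,b]ˣ) :
    (quatHaar a b).map (ξ * ·) = quatHaar a b := by
  have hm : Measurable fun η : ℍ[ℚ_[p],a,b]ˣ => (‖nrd a b η‖ₑ ^ 2)⁻¹ :=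
    (measurable_nrd_unit.enorm.pow_const 2).inv
  have hpos : ‖nrd a b ξ‖ₑ ^ 2 ≠ 0 := pow_ne_zero _ (enorm_ne_zero.2 (nrd_unit_ne_zero a b ξ))
  have hfin : ‖nrd a b ξ‖ₑ ^ 2 ≠ ∞ := ENNReal.pow_ne_top enorm_ne_top
  ext E hE
  rw [Measure.map_apply (measurable_const_mul ξ) hE, quatHaar_eq_withDensity,
    withDensity_apply _ hE, withDensity_apply _ (measurable_const_mul ξ hE)]
  conv_rhs => rw [← map_mul_left_addHaarUnits h0 ξ]
  rw [Measure.restrict_smul, lintegral_smul_measure,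
    setLIntegral_map hE hm (measurable_const_mul ξ), smul_eq_mul,
    ← lintegral_const_mul' _ _ hfin]
  refine lintegral_congr fun η => ?_
  rw [Units.val_mul, nrd_mul, enorm_mul, mul_pow, ENNReal.mul_inv (Or.inl hpos) (Or.inl hfin),
    ← mul_assoc, ENNReal.mul_inv_cancel hpos hfin, one_mul]

/-- The density of `quatHaar` lies between `1` and `p²` on the shell, which is compact and open, so
the shell has positive finite measure. -/
theorem isHaarMeasure_quatHaar (h0 : ∀ x, Q4 a b x = 0 → x = 0) :
    (quatHaar a b).IsHaarMeasure := by
  have : (quatHaar a b).IsMulLeftInvariant := ⟨map_mul_left_quatHaar h0⟩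
  have hp : (p : ℝ≥0) ≠ 0 := by exact_mod_cast (Fact.out : p.Prime).ne_zero
  have hS := isClopen_shell a b
  have hj := isOpenEmbedding_unitCoords a b
  have hm := hS.isOpen.measurableSet
  refine Measure.isHaarMeasure_of_isCompact_nonempty_interior _ (shell a b) (isCompact_shell h0)
    (hS.isOpen.interior_eq.symm ▸ ⟨1, one_mem_shell a b⟩) ?_ ?_
  · rw [quatHaar_eq_withDensity, withDensity_apply _ hm]
    refine (lt_of_lt_of_le ?_ (setLIntegral_mono' (f := fun _ => 1) hm fun ξ hξ => ?_)).ne'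
    · rw [setLIntegral_one, addHaarUnits_apply]
      exact (hj.isOpenMap _ hS.isOpen).measure_pos _ ⟨_, 1, one_mem_shell a b, rfl⟩
    · rw [ENNReal.one_le_inv]
      refine pow_le_one₀ zero_le ?_
      exact ENNReal.coe_le_one_iff.2 hξ.2
  · rw [quatHaar_eq_withDensity, withDensity_apply _ hm]
    refine (lt_of_le_of_lt (setLIntegral_mono' (g := fun _ => (p : ℝ≥0∞) ^ 2) hm fun ξ hξ => ?_)
      ?_).ne
    · rw [ENNReal.inv_le_iff_inv_le, ENNReal.inv_pow]
      gcongr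
      rw [← ENNReal.coe_natCast, ← ENNReal.coe_inv hp]
      refine ENNReal.coe_le_coe.2 (NNReal.coe_le_coe.1 ?_)
      simpa using hξ.1
    · rw [setLIntegral_const, addHaarUnits_apply]
      exact ENNReal.mul_lt_top (ENNReal.pow_lt_top (ENNReal.natCast_lt_top p))
        ((isCompact_shell h0).image hj.continuous).measure_lt_top

end HaarMeasure

/-! ### Weights -/

section Weights

variable {p : ℕ} [Fact p.Prime] {a b : ℚ_[p]}

instance : SecondCountableTopology ℚ_[p]ˣ :=
  Units.isEmbedding_val₀.secondCountableTopology

theorem continuous_scalar : Continuous (scalar a b) :=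
  (isEmbedding_units a b).continuous_iff.2 <| by
    apply continuous_quat <;> simp [scalar, QuaternionAlgebra.algebraMap_eq] <;> fun_prop

/-- The scalars carrying `ξ` into the shell form a coset of the units of `ℤ_p`. -/
theorem exists_mul_scalar_mem_shell_iff (ξ : ℍ[ℚ_[p],a,b]ˣ) : ∃ w : ℚ_[p]ˣ, ∀ z : ℚ_[p]ˣ,
    ξ * scalar a b z ∈ shell a b ↔ ‖((w * z : ℚ_[p]ˣ) : ℚ_[p])‖ = 1 := by
  have hp : p.Prime := Fact.out
  have h1 : (1 : ℝ) < p := by exact_mod_cast hp.one_lt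
  have h0 : (p : ℝ) ≠ 0 := by positivity
  have hp0 : (p : ℚ_[p]) ≠ 0 := by exact_mod_cast hp.ne_zero
  set k := (nrd a b ξ).valuation with hk
  -- With `m` the valuation of `z`, membership in the shell says `k + 2 m ∈ {0, 1}`, that is
  -- `m = -⌊k / 2⌋`.
  refine ⟨Units.mk0 (p : ℚ_[p]) hp0 ^ (k / 2), fun z => ?_⟩
  set m := (z : ℚ_[p]).valuation with hm
  have e1 : ‖nrd a b ((ξ * scalar a b z : ℍ[ℚ_[p],a,b]ˣ) : ℍ[ℚ_[p],a,b])‖ =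
      (p : ℝ) ^ (-(k + 2 * m)) := by
    rw [Units.val_mul, nrd_mul, nrd_scalar, norm_mul, norm_pow,
      Padic.norm_eq_zpow_neg_valuation (nrd_unit_ne_zero a b ξ),
      Padic.norm_eq_zpow_neg_valuation z.ne_zero, ← zpow_natCast, ← zpow_mul, ← zpow_add₀ h0]
    congr 1
    push_cast
    ring
  have e2 : ‖((Units.mk0 (p : ℚ_[p]) hp0 ^ (k / 2) * z : ℚ_[p]ˣ) : ℚ_[p])‖ =
      (p : ℝ) ^ (-(k / 2 + m)) := by
    rw [Units.val_mul, Units.val_zpow_eq_zpow_val, Units.val_mk0, norm_mul, norm_zpow, Padic.norm_p,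
      Padic.norm_eq_zpow_neg_valuation z.ne_zero, inv_zpow, ← zpow_neg, ← zpow_add₀ h0]
    congr 1
    ring
  rw [shell, Set.mem_ofPred_eq, e1, e2, ← zpow_neg_one, zpow_le_zpow_iff_right₀ h1,
    zpow_le_one_iff_right₀ h1, zpow_eq_one_iff_right₀ (by positivity) h1.ne']
  omega

theorem exists_mul_scalar_mem_shell (ξ : ℍ[ℚ_[p],a,b]ˣ) :
    ∃ z : ℚ_[p]ˣ, ξ * scalar a b z ∈ shell a b := by
  obtain ⟨w, hw⟩ := exists_mul_scalar_mem_shell_iff ξ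
  exact ⟨w⁻¹, (hw _).2 (by simp)⟩

theorem isCompact_isOpen_unitSphere : IsCompact {z : ℚ_[p]ˣ | ‖(z : ℚ_[p])‖ = 1} ∧
    IsOpen {z : ℚ_[p]ˣ | ‖(z : ℚ_[p])‖ = 1} := by
  have hS : {z : ℚ_[p]ˣ | ‖(z : ℚ_[p])‖ = 1} = Units.val ⁻¹' Metric.sphere 0 1 := by
    ext z
    simp
  rw [hS]
  refine ⟨?_, (IsUltrametricDist.isOpen_sphere _ one_ne_zero).preimage Units.continuous_val⟩
  refine Units.isEmbedding_val₀.isInducing.isCompact_preimage' (isCompact_sphere _ _) fun x hx => ?_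
  have hx0 : x ≠ 0 := by
    rintro rfl
    simp at hx
  exact ⟨Units.mk0 x hx0, rfl⟩

theorem exists_isWeight (h0 : ∀ x, Q4 a b x = 0 → x = 0) (μZ : Measure ℚ_[p]ˣ)
    [μZ.IsHaarMeasure] : ∃ ψ : ℍ[ℚ_[p],a,b]ˣ → ℝ, IsWeight μZ ψ := by
  set U := {z : ℚ_[p]ˣ | ‖(z : ℚ_[p])‖ = 1} with hU
  obtain ⟨hUc, hUo⟩ := isCompact_isOpen_unitSphere (p := p)
  have hpos : 0 < μZ.real U := ENNReal.toReal_pos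
    (hUo.measure_pos μZ ⟨1, by simp⟩).ne' hUc.measure_lt_top.ne
  refine ⟨(shell a b).indicator fun _ => (μZ.real U)⁻¹, ?_, ?_, ?_, ?_, ?_⟩
  · exact (isClopen_shell a b).continuous_indicator continuous_const
  · exact HasCompactSupport.intro (isCompact_shell h0) fun x hx => Set.indicator_of_notMem hx _
  · exact fun ξ => Set.indicator_nonneg (fun _ _ => (inv_pos.2 hpos).le) ξ
  · intro h
    have := congrFun h 1
    rw [Set.indicator_of_mem (one_mem_shell a b)] at this
    exact (inv_pos.2 hpos).ne' this
  · intro ξ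
    obtain ⟨w, hw⟩ := exists_mul_scalar_mem_shell_iff ξ
    have h1 : (fun z : ℚ_[p]ˣ => (shell a b).indicator (fun _ => (μZ.real U)⁻¹)
        (ξ * scalar a b z)) = ((w * ·) ⁻¹' U).indicator fun _ => (μZ.real U)⁻¹ := by
      ext z
      by_cases hz : ξ * scalar a b z ∈ shell a b
      · rw [Set.indicator_of_mem hz, Set.indicator_of_mem (show z ∈ (w * ·) ⁻¹' U from (hw z).1 hz)]
      · rw [Set.indicator_of_notMem hz, 
          Set.indicator_of_notMem (show z ∉ (w * ·) ⁻¹' U from mt (hw z).2 hz)]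
    rw [fiberIntegral, h1, integral_indicator_const _ (measurable_const_mul w hUo.measurableSet),
      measureReal_def, measure_preimage_mul, ← measureReal_def, smul_eq_mul,
      mul_inv_cancel₀ hpos.ne']

namespace IsWeight

variable {μZ : Measure ℚ_[p]ˣ} {ψ ψ' : ℍ[ℚ_[p],a,b]ˣ → ℝ}

theorem lintegral_fiber (h : IsWeight μZ ψ) (ξ : ℍ[ℚ_[p],a,b]ˣ) :
    ∫⁻ z, ENNReal.ofReal (ψ (ξ * scalar a b z)) ∂μZ = 1 := by
  have h1 := h.fiberIntegral_eq_one ξ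
  rw [fiberIntegral] at h1
  rw [← ofReal_integral_eq_lintegral_ofReal, h1, ENNReal.ofReal_one]
  · -- A function that is not integrable has integral zero by convention, not one.
    by_contra hn
    rw [integral_undef hn] at h1
    exact zero_ne_one h1
  · exact Filter.Eventually.of_forall fun z => h.nonneg _

theorem translate (h : IsWeight μZ ψ) (η : ℍ[ℚ_[p],a,b]ˣ) : IsWeight μZ fun ξ => ψ (η * ξ) where
  continuous := h.continuous.comp (continuous_const_mul η)
  hasCompactSupport := h.hasCompactSupport.comp_homeomorph (Homeomorph.mulLeft η)
  nonneg ξ := h.nonneg _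
  ne_zero := by
    intro h0
    refine h.ne_zero (funext fun ξ => ?_)
    have := congrFun h0 (η⁻¹ * ξ)
    simpa using this
  fiberIntegral_eq_one ξ := by
    have := h.fiberIntegral_eq_one (η * ξ)
    simpa only [fiberIntegral, mul_assoc] using this

/-- The integral of a weight against a function that is constant on the cosets of the non-zero
scalars does not depend on the weight: insert the fibre integral of the other weight, exchange the
integrals, and translate by the central element `z`. -/
theorem lintegral_mul_eq [μZ.IsHaarMeasure] (μH : Measure ℍ[ℚ_[p],a,b]ˣ) [μH.IsHaarMeasure]
    (h : IsWeight μZ ψ) (h' : IsWeight μZ ψ') {F : ℍ[ℚ_[p],a,b]ˣ → ENNReal} (hF : Measurable F)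
    (hFz : ∀ ξ z, F (ξ * scalar a b z) = F ξ) :
    ∫⁻ ξ, ENNReal.ofReal (ψ ξ) * F ξ ∂μH = ∫⁻ ξ, ENNReal.ofReal (ψ' ξ) * F ξ ∂μH := by
  have hm : ∀ {χ : ℍ[ℚ_[p],a,b]ˣ → ℝ}, Continuous χ → Measurable fun ξ => ENNReal.ofReal (χ ξ) :=
    fun hχ => hχ.measurable.ennreal_ofReal
  have hfib : ∀ {χ : ℍ[ℚ_[p],a,b]ˣ → ℝ}, Continuous χ → ∀ ξ,
      Measurable fun z => ENNReal.ofReal (χ (ξ * scalar a b z)) := fun hχ ξ =>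
    (hm hχ).comp ((continuous_const_mul ξ).comp continuous_scalar).measurable
  have hact : Continuous fun x : ℍ[ℚ_[p],a,b]ˣ × ℚ_[p]ˣ => x.1 * scalar a b x.2 :=
    continuous_fst.mul (continuous_scalar.comp continuous_snd)
  have hact' : Continuous fun x : ℍ[ℚ_[p],a,b]ˣ × ℚ_[p]ˣ => x.1 * scalar a b x.2⁻¹ :=
    continuous_fst.mul (continuous_scalar.comp continuous_snd.inv)
  calc ∫⁻ ξ, ENNReal.ofReal (ψ ξ) * F ξ ∂μH
      = ∫⁻ ξ, ∫⁻ z, ENNReal.ofReal (ψ ξ) * F ξ * ENNReal.ofReal (ψ' (ξ * scalar a b z))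
          ∂μZ ∂μH := by
        refine lintegral_congr fun ξ => ?_
        rw [lintegral_const_mul _ (hfib h'.continuous ξ), h'.lintegral_fiber, mul_one]
    _ = ∫⁻ z, ∫⁻ ξ, ENNReal.ofReal (ψ ξ) * F ξ * ENNReal.ofReal (ψ' (ξ * scalar a b z))
          ∂μH ∂μZ := by
        refine lintegral_lintegral_swap (Measurable.aemeasurable ?_)
        exact (((hm h.continuous).comp measurable_fst).mul (hF.comp measurable_fst)).mul
          ((hm h'.continuous).comp hact.measurable)
    _ = ∫⁻ z, ∫⁻ ξ, ENNReal.ofReal (ψ (ξ * scalar a b z⁻¹)) * F ξ * ENNReal.ofReal (ψ' ξ)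
          ∂μH ∂μZ := by
        refine lintegral_congr fun z => ?_
        rw [← lintegral_mul_left_eq_self _ (scalar a b z⁻¹)]
        refine lintegral_congr fun ξ => ?_
        rw [← scalar_comm, hFz, mul_assoc ξ, ← map_mul, inv_mul_cancel, map_one, mul_one]
    _ = ∫⁻ ξ, ∫⁻ z, ENNReal.ofReal (ψ (ξ * scalar a b z⁻¹)) * F ξ * ENNReal.ofReal (ψ' ξ)
          ∂μZ ∂μH := by
        refine (lintegral_lintegral_swap (Measurable.aemeasurable ?_)).symm
        exact (((hm h.continuous).comp hact'.measurable).mul (hF.comp measurable_fst)).mul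
          ((hm h'.continuous).comp measurable_fst)
    _ = ∫⁻ ξ, ENNReal.ofReal (ψ' ξ) * F ξ ∂μH := by
        refine lintegral_congr fun ξ => ?_
        have hmz : Measurable fun z => ENNReal.ofReal (ψ (ξ * scalar a b z⁻¹)) :=
          (hfib h.continuous ξ).comp measurable_inv
        simp_rw [mul_assoc]
        rw [lintegral_mul_const _ hmz,
          lintegral_inv_eq_self (μ := μZ) fun z => ENNReal.ofReal (ψ (ξ * scalar a b z)),
          h.lintegral_fiber, one_mul, mul_comm]

end IsWeight

end Weights

/-! ### The image of a weighted Haar measure on the rotation group -/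

section Pushforward

variable {p : ℕ} [Fact p.Prime] {a b : ℚ_[p]}

theorem continuous_rot (e : Frame a b) : Continuous (rot e) := by
  have hsymm : ∀ (f : ℍ[ℚ_[p],a,b]ˣ → pureQuat a b), Continuous (fun ξ => (f ξ : ℍ[ℚ_[p],a,b])) →
      Continuous fun ξ => e.equiv.symm (f ξ) := fun f hf => by
    have h1 : Continuous fun ξ => (ijk a b).symm (f ξ) := by
      refine continuous_pi fun i => ?_
      fin_cases i
      exacts [(continuous_imI a b).comp hf, (continuous_imJ a b).comp hf,
        (continuous_imK a b).comp hf]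
    have h2 := (LinearMap.continuous_on_pi
      ((e.equiv.symm : pureQuat a b →ₗ[ℚ_[p]] (Fin 3 → ℚ_[p])) ∘ₗ
        (ijk a b : (Fin 3 → ℚ_[p]) →ₗ[ℚ_[p]] pureQuat a b))).comp h1
    refine h2.congr fun ξ => ?_
    simp
  refine Continuous.subtype_mk (Continuous.subtype_mk ?_ _) _
  refine continuous_matrix fun i j => ?_
  simp only [LinearMap.toMatrix'_apply]
  refine (continuous_apply i).comp (hsymm (fun ξ => conj a b ξ (e.equiv (Pi.single j 1))) ?_)
  exact (Units.continuous_val.mul continuous_const).mul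
    (Units.continuous_val.comp continuous_inv)

theorem compactSpace_SO3 (h0 : ∀ x, Q4 a b x = 0 → x = 0)
    (e : Frame a b) :
    CompactSpace (SO3 a b) := by
  refine ⟨?_⟩
  have : (Set.univ : Set (SO3 a b)) = rot e '' shell a b := by
    refine (Set.eq_univ_of_forall fun R => ?_).symm
    obtain ⟨ξ, rfl⟩ := rot_surjective (fun _ => eq_zero_of_nrd_eq_zero h0) e R
    obtain ⟨z, hz⟩ := exists_mul_scalar_mem_shell ξ
    exact ⟨_, hz, rot_mul_scalar e ξ z⟩
  rw [this]
  exact (isCompact_shell h0).image (continuous_rot e)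

/-- The measure `E ↦ ∫ ψ · (1_E ∘ q)` on `SO(3)`. -/
noncomputable def weightMeasure (e : Frame a b) (μH : Measure ℍ[ℚ_[p],a,b]ˣ)
    (ψ : ℍ[ℚ_[p],a,b]ˣ → ℝ) : Measure (SO3 a b) :=
  (μH.withDensity fun ξ => ENNReal.ofReal (ψ ξ)).map (rot e)

theorem weightMeasure_apply (e : Frame a b) (μH : Measure ℍ[ℚ_[p],a,b]ˣ)
    (ψ : ℍ[ℚ_[p],a,b]ˣ → ℝ) {E : Set (SO3 a b)} (hE : MeasurableSet E) :
    weightMeasure e μH ψ E = ∫⁻ ξ, ENNReal.ofReal (ψ ξ) * E.indicator 1 (rot e ξ) ∂μH := by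
  have hr := (continuous_rot e).measurable
  rw [weightMeasure, Measure.map_apply hr hE, withDensity_apply _ (hr hE),
    ← lintegral_indicator (hr hE)]
  refine lintegral_congr fun ξ => ?_
  by_cases h : rot e ξ ∈ E
  · rw [Set.indicator_of_mem (show ξ ∈ rot e ⁻¹' E from h), Set.indicator_of_mem h, Pi.one_apply,
      mul_one]
  · rw [Set.indicator_of_notMem (show ξ ∉ rot e ⁻¹' E from h), Set.indicator_of_notMem h, mul_zero]

variable {μZ : Measure ℚ_[p]ˣ} [μZ.IsHaarMeasure] (μH : Measure ℍ[ℚ_[p],a,b]ˣ)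
  [μH.IsHaarMeasure] {ψ ψ' : ℍ[ℚ_[p],a,b]ˣ → ℝ}

theorem measurable_indicator_rot (e : Frame a b) {E : Set (SO3 a b)} (hE : MeasurableSet E) :
    Measurable fun ξ => E.indicator (1 : SO3 a b → ENNReal) (rot e ξ) :=
  (measurable_one.indicator hE).comp (continuous_rot e).measurable

theorem weightMeasure_eq (e : Frame a b) (h : IsWeight μZ ψ) (h' : IsWeight μZ ψ') :
    weightMeasure e μH ψ = weightMeasure e μH ψ' := by
  ext E hE
  rw [weightMeasure_apply e μH _ hE, weightMeasure_apply e μH _ hE]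
  exact h.lintegral_mul_eq μH h' (measurable_indicator_rot e hE) fun ξ z => by
    rw [rot_mul_scalar]

/-- A left translation of the weighted measure is the weighted measure of a translated weight. -/
theorem isMulLeftInvariant_weightMeasure (h0 : ∀ x, Q4 a b x = 0 → x = 0)
    (e : Frame a b) (h : IsWeight μZ ψ) : (weightMeasure e μH ψ).IsMulLeftInvariant := by
  refine ⟨fun R => ?_⟩
  obtain ⟨η, rfl⟩ := rot_surjective (fun _ => eq_zero_of_nrd_eq_zero h0) e R
  ext E hE
  have hm : Measurable (rot e η * · : SO3 a b → SO3 a b) := (continuous_const_mul _).measurable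
  conv_rhs => rw [weightMeasure_eq μH e h (h.translate η⁻¹), weightMeasure_apply e μH _ hE,
    ← lintegral_mul_left_eq_self (μ := μH) _ η]
  rw [Measure.map_apply hm hE, weightMeasure_apply e μH _ (hm hE)]
  refine lintegral_congr fun ξ => ?_
  rw [map_mul, inv_mul_cancel_left]
  rfl

theorem isHaarMeasure_weightMeasure (h0 : ∀ x, Q4 a b x = 0 → x = 0)
    (e : Frame a b) (h : IsWeight μZ ψ) : (weightMeasure e μH ψ).IsHaarMeasure := by
  have := compactSpace_SO3 h0 e
  have := isMulLeftInvariant_weightMeasure μH h0 e h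
  have huniv : weightMeasure e μH ψ Set.univ = ENNReal.ofReal (∫ ξ, ψ ξ ∂μH) := by
    rw [weightMeasure_apply e μH _ MeasurableSet.univ,
      ofReal_integral_eq_lintegral_ofReal
        (h.continuous.integrable_of_hasCompactSupport h.hasCompactSupport)
        (Filter.Eventually.of_forall h.nonneg)]
    simp
  obtain ⟨ξ, hξ⟩ := Function.ne_iff.1 h.ne_zero
  refine Measure.isHaarMeasure_of_isCompact_nonempty_interior _ Set.univ isCompact_univ
    (by simp) ?_ ?_
  · rw [huniv]
    exact (ENNReal.ofReal_pos.2 (h.continuous.integral_pos_of_hasCompactSupport_nonneg_nonzero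
      h.hasCompactSupport h.nonneg hξ)).ne'
  · rw [huniv]
    exact ENNReal.ofReal_ne_top

/-- The integral formula for an arbitrary pair of Haar measures: the weighted measure is a Haar
measure that is the same for all weights, so uniqueness of Haar measure gives the constant. -/
theorem exists_integral_eq_mul_integral_wmbLift (h0 : ∀ x, Q4 a b x = 0 → x = 0)
    (e : Frame a b)
    (μ₃ : Measure (SO3 a b)) [μ₃.IsHaarMeasure] (μZ : Measure ℚ_[p]ˣ) [μZ.IsHaarMeasure] :
    ∃ c : ℝ, 0 < c ∧ ∀ ψ : ℍ[ℚ_[p],a,b]ˣ → ℝ, IsWeight μZ ψ →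
      ∀ φ : SO3 a b → ℂ, Integrable φ μ₃ → Integrable (wmbLift e ψ φ) μH ∧
        ∫ R, φ R ∂μ₃ = c * ∫ ξ, wmbLift e ψ φ ξ ∂μH := by
  obtain ⟨ψ₀, hψ₀⟩ := exists_isWeight h0 μZ
  have := compactSpace_SO3 h0 e
  have := isHaarMeasure_weightMeasure μH h0 e hψ₀
  have hμ := Measure.isMulInvariant_eq_smul_of_compactSpace μ₃ (weightMeasure e μH ψ₀)
  set c := Measure.haarScalarFactor μ₃ (weightMeasure e μH ψ₀)
  have hc : 0 < c := Measure.haarScalarFactor_pos_of_isHaarMeasure _ _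
  refine ⟨c, hc, fun ψ hψ φ hφ => ?_⟩
  rw [weightMeasure_eq μH e hψ₀ hψ] at hμ
  have hφ' : Integrable φ (weightMeasure e μH ψ) := by
    rw [hμ] at hφ
    exact (integrable_smul_measure (ENNReal.coe_ne_zero.2 hc.ne') ENNReal.coe_ne_top).1 hφ
  have hr := (continuous_rot e).measurable
  have hm : Measurable fun ξ => (ψ ξ).toNNReal := hψ.continuous.measurable.real_toNNReal
  have hlift : wmbLift e ψ φ = fun ξ => (ψ ξ).toNNReal • φ (rot e ξ) := by
    ext ξ
    rw [wmbLift, NNReal.smul_def, Real.coe_toNNReal _ (hψ.nonneg ξ), Complex.real_smul]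
  constructor
  · rw [weightMeasure, integrable_map_measure hφ'.1 hr.aemeasurable] at hφ'
    rw [hlift]
    exact (integrable_withDensity_iff_integrable_smul hm).1 hφ'
  · have h1 := hφ'.1
    rw [hμ, integral_smul_nnreal_measure]
    rw [weightMeasure] at h1 ⊢
    rw [integral_map hr.aemeasurable h1, hlift, NNReal.smul_def, Complex.real_smul]
    congr 1
    exact integral_withDensity_eq_integral_smul hm _

end Pushforward

/-! ### Integration in coordinates -/

section Coordinates

variable {p : ℕ} [Fact p.Prime] {a b : ℚ_[p]}

/-- Integration against `quatHaar` in the coordinates. The integrand is supported on the image of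
the units, so the behaviour of the density at zeros of `Q4` does not matter. -/
theorem integrable_and_integral_quatHaar (F : ℍ[ℚ_[p],a,b]ˣ → ℂ) :
    (Integrable (fun x => Function.extend (unitCoords a b) F 0 x / (‖Q4 a b x‖ : ℂ) ^ 2)
      (lambda4 p) ↔ Integrable F (quatHaar a b)) ∧
    ∫ x, Function.extend (unitCoords a b) F 0 x / (‖Q4 a b x‖ : ℂ) ^ 2 ∂lambda4 p =
      ∫ ξ, F ξ ∂quatHaar a b := by
  have hj := measurableEmbedding_unitCoords a b
  set G : (Fin 4 → ℚ_[p]) → ℂ := fun x =>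
    Function.extend (unitCoords a b) F 0 x / (‖Q4 a b x‖ : ℂ) ^ 2 with hG
  have hsupp : Function.support G ⊆ Set.range (unitCoords a b) := by
    intro x hx
    by_contra hn
    refine hx ?_
    rw [hG]
    simp only
    rw [Function.extend_apply' _ _ _ hn, Pi.zero_apply, zero_div]
  have hcomp : G ∘ unitCoords a b = fun ξ : ℍ[ℚ_[p],a,b]ˣ => (‖nrd a b ξ‖₊ ^ 2)⁻¹ • F ξ := by
    ext ξ
    simp only [hG, Function.comp_apply, hj.injective.extend_apply, Q4_unitCoords, NNReal.smul_def,
      Complex.real_smul]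
    push_cast
    rw [div_eq_inv_mul]
  have hmap : (addHaarUnits a b).map (unitCoords a b) =
      (lambda4 p).restrict (Set.range (unitCoords a b)) := hj.map_comap _
  have hdens : quatHaar a b = (addHaarUnits a b).withDensity
      fun ξ => (((‖nrd a b ξ‖₊ ^ 2)⁻¹ : NNReal) : ENNReal) := by
    rw [quatHaar_eq_withDensity]
    congr 1
    funext ξ
    rw [ENNReal.coe_inv (pow_ne_zero _ (nnnorm_ne_zero_iff.2 (nrd_unit_ne_zero a b ξ)))]
    rfl
  have hm : Measurable fun ξ : ℍ[ℚ_[p],a,b]ˣ => (‖nrd a b ξ‖₊ ^ 2)⁻¹ :=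
    (measurable_nrd_unit.nnnorm.pow_const 2).inv
  constructor
  · rw [← integrableOn_iff_integrable_of_support_subset hsupp, IntegrableOn, ← hmap,
      hj.integrable_map_iff, hcomp, hdens, integrable_withDensity_iff_integrable_smul hm]
  · rw [← setIntegral_eq_integral_of_forall_compl_eq_zero (s := Set.range (unitCoords a b))
      fun x hx => Function.notMem_support.1 fun h => hx (hsupp h), ← hmap, hj.integral_map, hdens,
      integral_withDensity_eq_integral_smul hm]
    exact integral_congr_ae (Filter.Eventually.of_forall (congrFun hcomp))

end Coordinates

end PadicRotation

theorem mainTheorem9 (p : ℕ) [Fact p.Prime] (a b : ℚ_[p]) (hab : PadicRotation.IsStandardPair a b)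
    (e : PadicRotation.Frame a b)
    (μ₃ : Measure (PadicRotation.SO3 a b)) [μ₃.IsHaarMeasure]
    (μH : Measure ℍ[ℚ_[p],a,b]ˣ) [μH.IsHaarMeasure]
    (μZ : Measure ℚ_[p]ˣ) [μZ.IsHaarMeasure] :
    (PadicRotation.quatHaar a b).IsHaarMeasure ∧
    (∃ ψ : ℍ[ℚ_[p],a,b]ˣ → ℝ, PadicRotation.IsWeight μZ ψ) ∧
    (∃ c : ℝ, 0 < c ∧
      ∀ ψ : ℍ[ℚ_[p],a,b]ˣ → ℝ, PadicRotation.IsWeight μZ ψ →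
      ∀ φ : PadicRotation.SO3 a b → ℂ, Integrable φ μ₃ →
        Integrable (PadicRotation.wmbLift e ψ φ) μH ∧
        ∫ R, φ R ∂μ₃ = c * ∫ ξ, PadicRotation.wmbLift e ψ φ ξ ∂μH) ∧
    (∃ c : ℝ, 0 < c ∧
      ∀ ψ : ℍ[ℚ_[p],a,b]ˣ → ℝ, PadicRotation.IsWeight μZ ψ →
      ∀ φ : PadicRotation.SO3 a b → ℂ, Integrable φ μ₃ →
        Integrable (fun x => Function.extend (PadicRotation.unitCoords a b)
          (PadicRotation.wmbLift e ψ φ) 0 x / (‖PadicRotation.Q4 a b x‖ : ℂ) ^ 2)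
          (PadicRotation.lambda4 p) ∧
        ∫ R, φ R ∂μ₃ = c * ∫ x, Function.extend (PadicRotation.unitCoords a b)
          (PadicRotation.wmbLift e ψ φ) 0 x / (‖PadicRotation.Q4 a b x‖ : ℂ) ^ 2
          ∂PadicRotation.lambda4 p) := by
  have h0 : ∀ x, PadicRotation.Q4 a b x = 0 → x = 0 := fun _ => PadicRotation.Q4_anisotropic hab
  have hHaar := PadicRotation.isHaarMeasure_quatHaar h0
  refine ⟨hHaar, PadicRotation.exists_isWeight h0 μZ,
    PadicRotation.exists_integral_eq_mul_integral_wmbLift μH h0 e μ₃ μZ, ?_⟩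
  obtain ⟨c, hc, h⟩ := PadicRotation.exists_integral_eq_mul_integral_wmbLift
    (PadicRotation.quatHaar a b) h0 e μ₃ μZ
  refine ⟨c, hc, fun ψ hψ φ hφ => ?_⟩
  obtain ⟨h1, h2⟩ := PadicRotation.integrable_and_integral_quatHaar
    (PadicRotation.wmbLift e ψ φ)
  rw [h1, h2]
  exact h ψ hψ φ hφ
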